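/- Let $dA=\pi^{-1}\,dx\,dy$ on $\mathbb{C}$. For $m>0$ and integers $n,q\ge 1$ let $\mathrm{Pol}_{m,n,q}$ be the span of the functions $z^j\bar z^k$, $0\le j\le n-1$, $0\le k\le q-1$, as a subspace of $L^2(\mathbb{C},e^{-m|z|^2}dA)$, and let $K_{m,n,q}$ be its reproducing kernel, i.e. $K_{m,n,q}(\cdot,w)\in\mathrm{Pol}_{m,n,q}$ and $f(w)=\int_{\mathbb{C}}f(z)\overline{K_{m,n,q}(z,w)}e^{-m|z|^2}dA(z)$ for all $f\in\mathrm{Pol}_{m,n,q}$, $w\in\mathbb{C}$. For $z\in\mathbb{C}$ define the Berezin density, the Berezin measure and the blow-up Berezin density by \[ b^{\langle z\rangle}_{m,n,q}(w)=\frac{|K_{m,n,q}(z,w)|^2}{K_{m,n,q}(z,z)}e^{-m|w|^2},\qquad dB^{\langle z\rangle}_{m,n,q}=b^{\langle z\rangle}_{m,n,q}\,dA,\qquad \hat b^{\langle z\rangle}_{m,n,q}(\xi)=m^{-1}\,b^{\langle z\rangle}_{m,n,q}(z+m^{-1/2}\xi). \] Let $L^{1}_{k}(x)=\sum_{i=0}^{k}(-1)^i\binom{k+1}{k-i}\frac{x^i}{i!}$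 be the generalized Laguerre polynomial of parameter $1$. Fix an integer $q\ge1$ and a point $z$ with $|z|<1$. Then, as $m,n\to+\infty$ with $n=m+O(1)$ (that is, for every constant $M$, as $m,n\to+\infty$ with $m$ real, $n$ integer and $|n-m|\le M$), \[ \int_{\mathbb{C}}\Big|\hat b^{\langle z\rangle}_{m,n,q}(\xi)-q^{-1}L^{1}_{q-1}(|\xi|^2)^2e^{-|\xi|^2}\Big|\,dA(\xi)\longrightarrow 0 . \] Moreover, in the same limit, the measures $dB^{\langle z\rangle}_{m,n,q}$ are eventually probability measures and converge weakly to $\delta_z$: $\int_{\mathbb{C}} f\,dB^{\langle z\rangle}_{m,n,q}\to f(z)$ for every bounded continuous $f:\mathbb{C}\to\mathbb{R}$. -/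

import Mathlib

open MeasureTheory Filter Topology
open scoped ComplexConjugate ENNReal BoundedContinuousFunction

namespace PolyGinibre

/-- The normalized area measure `dA = π⁻¹ dx dy` on the complex plane. -/
noncomputable def dA : Measure ℂ := ENNReal.ofReal Real.pi⁻¹ • volume

/-- The space of polyanalytic polynomials: the complex span of the functions
`z ↦ z ^ j * conj z ^ k`, `0 ≤ j ≤ n - 1`, `0 ≤ k ≤ q - 1`. -/
def Pol (n q : ℕ) : Submodule ℂ (ℂ → ℂ) :=
  Submodule.span ℂ {f | ∃ j < n, ∃ k < q, f = fun z => z ^ j * conj z ^ k}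

/-- `K` is a reproducing kernel of the function space `V`, where `V` carries the inner product
`⟨f, g⟩ = ∫ f(z) conj(g(z)) exp(-m |z|²) dA(z)` of `L²(ℂ, exp(-m |z|²))`. -/
structure IsReproducingKernel (m : ℝ) (V : Submodule ℂ (ℂ → ℂ)) (K : ℂ → ℂ → ℂ) : Prop where
  mem : ∀ w, (fun z => K z w) ∈ V
  reproducing : ∀ f ∈ V, ∀ w,
    ∫ z, f z * conj (K z w) * (Real.exp (-m * ‖z‖ ^ 2) : ℂ) ∂dA = f w

open Classical in
/-- The reproducing kernel `K_{m,n,q}` of `Pol n q` as a subspace of `L²(ℂ, exp(-m |z|²))`.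
For `m > 0` it exists and is unique, see `isReproducingKernel_polyKernel` and
`IsReproducingKernel.unique`. -/
noncomputable def polyKernel (m : ℝ) (n q : ℕ) : ℂ → ℂ → ℂ :=
  if h : ∃ K, IsReproducingKernel m (Pol n q) K then h.choose else 0

/-- The Berezin density `w ↦ |K(z,w)|² / K(z,z) * exp(-m |w|²)` for `K = K_{m,n,q}`
(the diagonal value `K(z,z)` is real). -/
noncomputable def berezinDensity (m : ℝ) (n q : ℕ) (z w : ℂ) : ℝ :=
  ‖polyKernel m n q z w‖ ^ 2 / (polyKernel m n q z z).re * Real.exp (-m * ‖w‖ ^ 2)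

/-- The Berezin measure. -/
noncomputable def berezinMeasure (m : ℝ) (n q : ℕ) (z : ℂ) : Measure ℂ :=
  dA.withDensity fun w => ENNReal.ofReal (berezinDensity m n q z w)

/-- The blow-up Berezin density `ξ ↦ m⁻¹ * B(z + m^{-1/2} ξ)`. -/
noncomputable def blowupBerezinDensity (m : ℝ) (n q : ℕ) (z ξ : ℂ) : ℝ :=
  m⁻¹ * berezinDensity m n q z (z + (((Real.sqrt m)⁻¹ : ℝ) : ℂ) * ξ)

/-- The generalized Laguerre polynomial
`L^α_k(x) = ∑_{i ≤ k} (-1)^i (α + i + 1)_{k-i} / (i! (k-i)!) x^i`, where `(·)_j` is the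
(rising) Pochhammer symbol. -/
noncomputable def laguerre (α : ℝ) (k : ℕ) (x : ℝ) : ℝ :=
  ∑ i ∈ Finset.range (k + 1),
    (-1) ^ i * (ascPochhammer ℝ (k - i)).eval (α + i + 1)
      / ((i.factorial : ℝ) * ((k - i).factorial : ℝ)) * x ^ i

/-- The limit density `q⁻¹ L^1_{q-1}(|ξ|²)² exp(-|ξ|²)`. -/
noncomputable def limitDensity (q : ℕ) (ξ : ℂ) : ℝ :=
  (q : ℝ)⁻¹ * laguerre 1 (q - 1) (‖ξ‖ ^ 2) ^ 2 * Real.exp (-‖ξ‖ ^ 2)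

/-- The filter on pairs `(m, n)` expressing that `m, n → ∞` while `|n - m| ≤ M`
(`m` a real parameter, `n` an integer). -/
def jointLimit (M : ℝ) : Filter (ℝ × ℕ) :=
  (atTop ×ˢ atTop) ⊓ 𝓟 {p | |(p.2 : ℝ) - p.1| ≤ M}

/-! Existence and uniqueness of the reproducing kernel. -/

theorem IsReproducingKernel.unique {m : ℝ} {V : Submodule ℂ (ℂ → ℂ)} {K K' : ℂ → ℂ → ℂ}
    (h : IsReproducingKernel m V K) (h' : IsReproducingKernel m V K') : K = K' := by
  have key : ∀ {K K' : ℂ → ℂ → ℂ}, IsReproducingKernel m V K → IsReproducingKernel m V K' →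
      ∀ a b, K a b = conj (K' b a) := by
    intro K K' h h' a b
    have h1 := h'.reproducing _ (h.mem b) a
    have h2 := h.reproducing _ (h'.mem a) b
    rw [← h1, ← h2, ← integral_conj]
    congr 1
    ext z
    simp only [map_mul, Complex.conj_conj, Complex.conj_ofReal]
    ring
  funext a b
  rw [key h h' a b, key h' h' a b]

theorem continuous_of_mem_Pol {n q : ℕ} {f : ℂ → ℂ} (hf : f ∈ Pol n q) : Continuous f := by
  induction hf using Submodule.span_induction with
  | mem f hf =>
    obtain ⟨j, -, k, -, rfl⟩ := hf
    have : Continuous (fun z : ℂ => conj z) := Complex.continuous_conj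
    fun_prop
  | zero => exact continuous_const
  | add f g _ _ hf hg => exact hf.add hg
  | smul a f _ hf => exact hf.const_smul a

theorem growth_of_mem_Pol {n q : ℕ} {f : ℂ → ℂ} (hf : f ∈ Pol n q) {a : ℝ} (ha : 0 < a) :
    ∃ C : ℝ, ∀ z, ‖f z‖ ≤ C * Real.exp (a * ‖z‖ ^ 2) := by
  induction hf using Submodule.span_induction with
  | mem f hf =>
    obtain ⟨j, -, k, -, rfl⟩ := hf
    refine ⟨1 + (j + k).factorial / a ^ (j + k), fun z => ?_⟩
    have h1 : ‖z ^ j * conj z ^ k‖ = ‖z‖ ^ (j + k) := by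
      rw [norm_mul, norm_pow, norm_pow, RCLike.norm_conj, pow_add]
    have h2 : ‖z‖ ^ (j + k) ≤ 1 + (‖z‖ ^ 2) ^ (j + k) := by
      rw [← pow_mul, mul_comm, pow_mul]
      nlinarith [sq_nonneg (‖z‖ ^ (j + k) - 1), pow_nonneg (norm_nonneg z) (j + k)]
    have h3 := Real.pow_div_factorial_le_exp (a * ‖z‖ ^ 2) (by positivity) (j + k)
    have h4 : 1 ≤ Real.exp (a * ‖z‖ ^ 2) := Real.one_le_exp (by positivity)
    have h5 : (‖z‖ ^ 2) ^ (j + k) ≤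
        (j + k).factorial / a ^ (j + k) * Real.exp (a * ‖z‖ ^ 2) := by
      rw [div_mul_eq_mul_div, le_div_iff₀ (by positivity)]
      rw [div_le_iff₀ (by positivity), mul_pow] at h3
      linarith
    rw [h1]
    linarith
  | zero => exact ⟨0, fun z => by simp⟩
  | add f g _ _ hf hg =>
    obtain ⟨C, hC⟩ := hf
    obtain ⟨D, hD⟩ := hg
    refine ⟨C + D, fun z => (norm_add_le _ _).trans ?_⟩
    rw [add_mul]
    exact add_le_add (hC z) (hD z)
  | smul c f _ hf =>
    obtain ⟨C, hC⟩ := hf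
    refine ⟨‖c‖ * C, fun z => ?_⟩
    rw [Pi.smul_apply, norm_smul, mul_assoc]
    exact mul_le_mul_of_nonneg_left (hC z) (norm_nonneg c)

theorem integrable_exp_neg {b : ℝ} (hb : 0 < b) :
    Integrable (fun z : ℂ => Real.exp (-b * ‖z‖ ^ 2)) dA := by
  refine Integrable.smul_measure ?_ ENNReal.ofReal_ne_top
  have h := GaussianFourier.integrable_cexp_neg_mul_sq_norm_add (V := ℂ) (b := (b : ℂ))
    (by simpa using hb) 0 0
  refine h.norm.congr (ae_of_all _ fun z => ?_)
  simp only [Complex.norm_exp]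
  congr 1
  simp [← Complex.ofReal_pow]

theorem integrable_mul_of_mem_Pol {m : ℝ} (hm : 0 < m) {n q : ℕ} {f g : ℂ → ℂ}
    (hf : f ∈ Pol n q) (hg : g ∈ Pol n q) :
    Integrable (fun z => f z * conj (g z) * (Real.exp (-m * ‖z‖ ^ 2) : ℂ)) dA := by
  obtain ⟨C, hC⟩ := growth_of_mem_Pol hf (a := m / 4) (by positivity)
  obtain ⟨D, hD⟩ := growth_of_mem_Pol hg (a := m / 4) (by positivity)
  have hfc := continuous_of_mem_Pol hf
  have hgc := Complex.continuous_conj.comp (continuous_of_mem_Pol hg)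
  have hec : Continuous fun z : ℂ => (Real.exp (-m * ‖z‖ ^ 2) : ℂ) :=
    Complex.continuous_ofReal.comp (by fun_prop)
  refine ((integrable_exp_neg (b := m / 2) (by positivity)).const_mul (C * D)).mono'
    ((hfc.mul hgc).mul hec).aestronglyMeasurable (ae_of_all _ fun z => ?_)
  rw [norm_mul, norm_mul, RCLike.norm_conj, Complex.norm_real, Real.norm_eq_abs, Real.abs_exp]
  have h1 : Real.exp (-(m / 2) * ‖z‖ ^ 2) =
      Real.exp (m / 4 * ‖z‖ ^ 2) * Real.exp (m / 4 * ‖z‖ ^ 2) * Real.exp (-m * ‖z‖ ^ 2) := by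
    rw [← Real.exp_add, ← Real.exp_add]
    congr 1
    ring
  rw [h1]
  calc ‖f z‖ * ‖g z‖ * Real.exp (-m * ‖z‖ ^ 2)
      ≤ (C * Real.exp (m / 4 * ‖z‖ ^ 2)) * (D * Real.exp (m / 4 * ‖z‖ ^ 2))
          * Real.exp (-m * ‖z‖ ^ 2) := by
        refine mul_le_mul_of_nonneg_right ?_ (Real.exp_pos _).le
        exact mul_le_mul (hC z) (hD z) (norm_nonneg _) ((norm_nonneg _).trans (hC z))
    _ = _ := by ring

theorem eq_zero_of_integral_eq_zero {m : ℝ} (hm : 0 < m) {n q : ℕ} {f : ℂ → ℂ}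
    (hf : f ∈ Pol n q)
    (h : ∫ z, f z * conj (f z) * (Real.exp (-m * ‖z‖ ^ 2) : ℂ) ∂dA = 0) : f = 0 := by
  have hfc := continuous_of_mem_Pol hf
  have hrew : ∀ z, f z * conj (f z) * (Real.exp (-m * ‖z‖ ^ 2) : ℂ) =
      ((‖f z‖ ^ 2 * Real.exp (-m * ‖z‖ ^ 2) : ℝ) : ℂ) := by
    intro z
    rw [Complex.mul_conj, Complex.normSq_eq_norm_sq]
    push_cast
    rfl
  have hint := integrable_mul_of_mem_Pol hm hf hf
  simp only [hrew] at h hint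
  have hint' : Integrable (fun z => ‖f z‖ ^ 2 * Real.exp (-m * ‖z‖ ^ 2)) dA := by
    refine hint.re.congr (ae_of_all _ fun z => ?_)
    exact Complex.ofReal_re _
  rw [integral_complex_ofReal, Complex.ofReal_eq_zero,
    integral_eq_zero_iff_of_nonneg (fun z => by positivity) hint'] at h
  have hc : ENNReal.ofReal Real.pi⁻¹ ≠ 0 := by
    simpa using Real.pi_pos
  have h' : (fun z => ‖f z‖ ^ 2 * Real.exp (-m * ‖z‖ ^ 2)) =ᵐ[(volume : Measure ℂ)] 0 := by
    rw [dA] at h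
    rw [Filter.EventuallyEq, Measure.ae_ennreal_smul_measure_iff hc] at h
    exact h
  have h2 := Measure.eq_of_ae_eq h' (by fun_prop) continuous_const
  funext z
  have h3 := congrFun h2 z
  simpa [(Real.exp_pos _).ne'] using h3

theorem finiteDimensional_Pol (n q : ℕ) : FiniteDimensional ℂ (Pol n q) := by
  refine FiniteDimensional.span_of_finite ℂ ?_
  refine (Set.Finite.image (fun p : ℕ × ℕ => fun z : ℂ => z ^ p.1 * conj z ^ p.2)
    ((Set.finite_Iio n).prod (Set.finite_Iio q))).subset ?_
  rintro f ⟨j, hj, k, hk, rfl⟩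
  exact ⟨(j, k), ⟨hj, hk⟩, rfl⟩

theorem exists_riesz {F : Type*} [AddCommGroup F] [Module ℂ F] [FiniteDimensional ℂ F]
    (core : InnerProductSpace.Core ℂ F) (φ : F →ₗ[ℂ] ℂ) :
    ∃ k : F, ∀ f : F, core.inner k f = φ f := by
  let _ : NormedAddCommGroup F := core.toNormedAddCommGroup
  let _ : InnerProductSpace ℂ F := InnerProductSpace.ofCore core.toCore
  have : CompleteSpace F := FiniteDimensional.complete ℂ F
  refine ⟨(InnerProductSpace.toDual ℂ F).symm (LinearMap.toContinuousLinearMap φ), fun f => ?_⟩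
  exact InnerProductSpace.toDual_symm_apply (𝕜 := ℂ) (E := F) (x := f)
    (y := LinearMap.toContinuousLinearMap φ)

theorem exists_isReproducingKernel {m : ℝ} (hm : 0 < m) (n q : ℕ) :
    ∃ K, IsReproducingKernel m (Pol n q) K := by
  let core : InnerProductSpace.Core ℂ (Pol n q) :=
    { inner := fun g f => ∫ z, f.1 z * conj (g.1 z) * (Real.exp (-m * ‖z‖ ^ 2) : ℂ) ∂dA
      conj_inner_symm := fun f g => by
        rw [← integral_conj]
        congr 1
        ext z
        simp only [map_mul, Complex.conj_conj, Complex.conj_ofReal]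
        ring
      re_inner_nonneg := fun f => by
        have hrew : ∀ z, f.1 z * conj (f.1 z) * (Real.exp (-m * ‖z‖ ^ 2) : ℂ) =
            ((‖f.1 z‖ ^ 2 * Real.exp (-m * ‖z‖ ^ 2) : ℝ) : ℂ) := by
          intro z
          rw [Complex.mul_conj, Complex.normSq_eq_norm_sq]
          push_cast
          rfl
        simp only [hrew]
        rw [integral_complex_ofReal]
        exact integral_nonneg fun z => by positivity
      add_left := fun f g h => by
        rw [← integral_add (integrable_mul_of_mem_Pol hm h.2 f.2)
          (integrable_mul_of_mem_Pol hm h.2 g.2)]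
        congr 1
        ext z
        simp only [Submodule.coe_add, Pi.add_apply, map_add]
        ring
      smul_left := fun f g c => by
        rw [← integral_const_mul]
        congr 1
        ext z
        simp only [Submodule.coe_smul, Pi.smul_apply, smul_eq_mul, map_mul]
        ring
      definite := fun f h => Subtype.ext (eq_zero_of_integral_eq_zero hm f.2 h) }
  have := finiteDimensional_Pol n q
  choose k hk using fun w : ℂ =>
    exists_riesz core ((LinearMap.proj w).comp (Pol n q).subtype)
  exact ⟨fun z w => (k w).1 z, fun w => (k w).2, fun f hf w => hk w ⟨f, hf⟩⟩

/-- For `m > 0` the kernel `polyKernel m n q` is the reproducing kernel of `Pol n q`. -/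
theorem isReproducingKernel_polyKernel {m : ℝ} (hm : 0 < m) (n q : ℕ) :
    IsReproducingKernel m (Pol n q) (polyKernel m n q) := by
  have h := exists_isReproducingKernel hm n q
  rw [polyKernel, dif_pos h]
  exact h.choose_spec

end PolyGinibre

open PolyGinibre

/-!
The space of all `q`-analytic functions in `L²(exp (-m |w|²) dA)` has at the point `a` the kernel
`κ(w) = m L^1_{q-1}(m |w - a|²) exp (m w conj a)`, whose normalized density, blown up around `a` at
the scale `m ^ {-1/2}`, is exactly the limit density. The reproducing property of `κ` against
elements of `Pol n q` reduces to the vanishing of the moments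
`∫₀^∞ L^1_{q-1}(x) x ^ k exp (-x) dx` for `1 ≤ k < q`, that is, to the vanishing of a `q`-th finite
difference (`sum_laguerreCoeff_mul_factorial`, `integral_mul_exp_mul_laguerre`).

Consequently `K_{m,n,q}(·, a)` is the orthogonal projection of `κ` to `Pol n q`, and it suffices to
approximate `κ` in `L²` by some element of `Pol n q` with a small relative error: Pythagoras'
theorem and the inequality `||x|² - |y|²| ≤ (1 + 1/t) |x - y|² + t |y|²` then show that the
normalized densities are close in `L¹` (`integral_norm_sub_sq_projection`,
`integral_abs_density_sub_le`). The approximant replaces `exp (m w conj a)` by its Taylor polynomial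
with `n - q` terms (`truncatedKernel`). The remainder is estimated pointwise by
`|exp x - ∑_{j < N} x ^ j / j!| ≤ s ^ {-N} exp (s |x|)` for `s ≥ 1`; with the Gaussian weight and
`n = m + O(1)` the square of the relative error is, up to an arbitrarily small loss in the exponent,
of order `exp (-m (log s² - |a|² (s² - 1)))`. This is exponentially small for
`s² = 2 / (1 + |a|²)` because `|a| < 1` (`exists_exponent`, `exists_mem_Pol_integral_le`).

All computations take place in the blow-up coordinate `ξ`, where `w = a + ξ / √m`
(`blowupTransform`): the weight becomes `exp (-|ξ|²)`, and `κ` becomes the real function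
`L^1_{q-1}(|ξ|²)` up to a constant factor. Weak convergence of the Berezin measures follows from the
convergence in `L¹`, a change of variables and dominated convergence.
-/

namespace PolyGinibre

/-! ### The Laguerre polynomial of parameter one -/

/-- The coefficient of `x ^ i` in the Laguerre polynomial `L^1_{q-1}`. -/
noncomputable def laguerreCoeff (q i : ℕ) : ℝ := (-1) ^ i * q.choose (i + 1) / i.factorial

theorem laguerre_one_eq_sum {q : ℕ} (hq : 1 ≤ q) (x : ℝ) :
    laguerre 1 (q - 1) x = ∑ i ∈ Finset.range q, laguerreCoeff q i * x ^ i := by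
  rw [laguerre, Nat.sub_add_cancel hq]
  refine Finset.sum_congr rfl fun i hi => ?_
  obtain ⟨d, rfl⟩ : ∃ d, q = i + 1 + d := ⟨q - (i + 1), by have := Finset.mem_range.1 hi; omega⟩
  have h1 : i + 1 + d - 1 - i = d := by omega
  have h2 : (ascPochhammer ℝ d).eval (1 + (i : ℝ) + 1) = ((i + 1 + 1).ascFactorial d : ℕ) := by
    rw [← ascPochhammer_nat_eq_ascFactorial, ascPochhammer_eval_cast]
    push_cast
    ring_nf
  have h3 : (((i + 1).factorial * (i + 1 + 1).ascFactorial d : ℕ) : ℝ) = (i + 1 + d).factorial := by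
    rw [Nat.factorial_mul_ascFactorial]
  rw [h1, h2, laguerreCoeff, Nat.cast_add_choose, ← h3]
  push_cast
  have := (i + 1).factorial_pos
  have := i.factorial_pos
  have := d.factorial_pos
  field_simp

/-- The moments `∫₀^∞ L^1_{q-1}(x) x ^ k e ^ {-x} dx` vanish for `1 ≤ k < q`, and the zeroth one is
`1`. Up to the term of index `0`, the sum is a `q`-th finite difference of the polynomial
`s (s + 1) ⋯ (s + k - 1)`, whose degree is less than `q`. -/
theorem sum_laguerreCoeff_mul_factorial {q k : ℕ} (hk : k < q) :
    ∑ i ∈ Finset.range q, laguerreCoeff q i * (k + i).factorial = if k = 0 then 1 else 0 := by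
  have h0 : (ascPochhammer ℝ k).natDegree < q := by rwa [ascPochhammer_natDegree]
  have h1 := congrFun (Polynomial.fwdDiff_iter_eq_zero_of_degree_lt h0) 0
  rw [fwdDiff_iter_eq_sum_shift, Finset.sum_range_succ'] at h1
  have h2 : ∀ i ∈ Finset.range q, laguerreCoeff q i * (k + i).factorial = (-1) ^ (q - 1) *
      (((-1 : ℤ) ^ (q - (i + 1)) * q.choose (i + 1)) •
        (ascPochhammer ℝ k).eval (0 + (i + 1) • (1 : ℝ))) := by
    intro i hi
    obtain ⟨d, rfl⟩ : ∃ d, q = i + 1 + d := ⟨q - (i + 1), by have := Finset.mem_range.1 hi; omega⟩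
    have h3 : (((i.factorial * (i + 1).ascFactorial k : ℕ)) : ℝ) = (k + i).factorial := by
      rw [Nat.factorial_mul_ascFactorial, add_comm]
    have h4 : (ascPochhammer ℝ k).eval (0 + (i + 1) • (1 : ℝ)) = ((i + 1).ascFactorial k : ℕ) := by
      rw [← ascPochhammer_nat_eq_ascFactorial, ascPochhammer_eval_cast]
      congr 1
      simp
    have h5 : (-1 : ℝ) ^ (i + d) * (-1) ^ d = (-1) ^ i := by
      rw [pow_add, mul_assoc, ← mul_pow]
      simp
    rw [h4, ← h3, laguerreCoeff, ← h5, show i + 1 + d - 1 = i + d by omega,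
      show i + 1 + d - (i + 1) = d by omega, zsmul_eq_mul]
    push_cast
    have := i.factorial_pos
    field_simp
  rw [Finset.sum_congr rfl h2, ← Finset.mul_sum]
  have h6 : (-1 : ℝ) ^ (q - 1) * (-1) ^ q = -1 := by
    obtain ⟨r, rfl⟩ : ∃ r, q = r + 1 := ⟨q - 1, by omega⟩
    rw [Nat.add_sub_cancel, pow_succ, ← mul_assoc, ← mul_pow]
    simp
  rw [eq_neg_of_add_eq_zero_left h1]
  have h7 : (ascPochhammer ℝ k).eval (0 + 0 • (1 : ℝ)) = if k = 0 then 1 else 0 := by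
    simp [ascPochhammer_eval_zero]
  rw [h7]
  simp only [Nat.sub_zero, Nat.choose_zero_right, zsmul_eq_mul]
  push_cast
  rw [mul_neg, mul_one, ← mul_assoc, h6]
  ring

theorem laguerre_one_zero {q : ℕ} (hq : 1 ≤ q) : laguerre 1 (q - 1) 0 = q := by
  rw [laguerre_one_eq_sum hq, Finset.sum_eq_single_of_mem 0 (Finset.mem_range.2 hq)]
  · simp [laguerreCoeff]
  · intro i _ hi
    simp [hi]

/-! ### Functions of subgaussian growth -/

/-- Continuous functions that are `O(exp (a |z|²))` for every `a > 0`. -/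
structure IsSubgaussian (f : ℂ → ℂ) : Prop where
  continuous : Continuous f
  bound : ∀ a : ℝ, 0 < a → ∃ C, ∀ z, ‖f z‖ ≤ C * Real.exp (a * ‖z‖ ^ 2)

namespace IsSubgaussian

variable {f g : ℂ → ℂ}

theorem mul (hf : IsSubgaussian f) (hg : IsSubgaussian g) :
    IsSubgaussian fun z => f z * g z := by
  refine ⟨hf.continuous.mul hg.continuous, fun a ha => ?_⟩
  obtain ⟨C, hC⟩ := hf.bound (a / 2) (by positivity)
  obtain ⟨D, hD⟩ := hg.bound (a / 2) (by positivity)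
  refine ⟨C * D, fun z => ?_⟩
  have h : Real.exp (a * ‖z‖ ^ 2) =
      Real.exp (a / 2 * ‖z‖ ^ 2) * Real.exp (a / 2 * ‖z‖ ^ 2) := by
    rw [← Real.exp_add]
    ring_nf
  rw [norm_mul, h, mul_mul_mul_comm]
  exact mul_le_mul (hC z) (hD z) (norm_nonneg _) ((norm_nonneg _).trans (hC z))

theorem of_mem_Pol {n q : ℕ} (hf : f ∈ Pol n q) : IsSubgaussian f :=
  ⟨continuous_of_mem_Pol hf, fun _ ha => growth_of_mem_Pol hf ha⟩

theorem of_bound (hf : Continuous f) {b : ℝ} (hb : ∀ z, ‖f z‖ ≤ Real.exp (b * ‖z‖)) :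
    IsSubgaussian f := by
  refine ⟨hf, fun a ha => ⟨Real.exp (b ^ 2 / (4 * a)), fun z => (hb z).trans ?_⟩⟩
  rw [← Real.exp_add, Real.exp_le_exp]
  have : b ^ 2 / (4 * a) + a * ‖z‖ ^ 2 - b * ‖z‖ = (b - 2 * a * ‖z‖) ^ 2 / (4 * a) := by
    field_simp
    ring
  have : 0 ≤ (b - 2 * a * ‖z‖) ^ 2 / (4 * a) := by positivity
  linarith

theorem exp_mul (c : ℂ) : IsSubgaussian fun z => Complex.exp (c * z) := by
  refine of_bound (b := ‖c‖) (by fun_prop) fun z => ?_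
  rw [← norm_mul]
  exact Complex.norm_exp_le_exp_norm _

theorem integrable (hf : IsSubgaussian f) {b : ℝ} (hb : 0 < b) :
    Integrable (fun z => f z * (Real.exp (-b * ‖z‖ ^ 2) : ℂ)) dA := by
  obtain ⟨C, hC⟩ := hf.bound (b / 2) (by positivity)
  have hec : Continuous fun z : ℂ => (Real.exp (-b * ‖z‖ ^ 2) : ℂ) :=
    Complex.continuous_ofReal.comp (by fun_prop)
  refine ((integrable_exp_neg (b := b / 2) (by positivity)).const_mul C).mono'
    (hf.continuous.mul hec).aestronglyMeasurable (ae_of_all _ fun z => ?_)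
  rw [norm_mul, Complex.norm_real, Real.norm_eq_abs, Real.abs_exp]
  calc _ ≤ C * Real.exp (b / 2 * ‖z‖ ^ 2) * Real.exp (-b * ‖z‖ ^ 2) := by
        gcongr
        exact hC z
    _ = _ := by
        rw [mul_assoc, ← Real.exp_add]
        ring_nf

theorem integrable_norm_sq (hf : IsSubgaussian f) {b : ℝ} (hb : 0 < b) :
    Integrable (fun z => ‖f z‖ ^ 2 * Real.exp (-b * ‖z‖ ^ 2)) dA := by
  refine ((hf.mul hf).integrable hb).norm.congr (ae_of_all _ fun z => ?_)
  simp only [norm_mul, Complex.norm_real, Real.norm_eq_abs, Real.abs_exp]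
  ring

/-- Multiplication by the square root of the Gaussian weight maps subgaussian functions
to `L²`. -/
theorem memLp (hf : IsSubgaussian f) :
    MemLp (fun z => f z * (Real.exp (-‖z‖ ^ 2 / 2) : ℂ)) 2 dA := by
  have hec : Continuous fun z : ℂ => (Real.exp (-‖z‖ ^ 2 / 2) : ℂ) :=
    Complex.continuous_ofReal.comp (by fun_prop)
  have hc : Continuous fun z => f z * (Real.exp (-‖z‖ ^ 2 / 2) : ℂ) := hf.continuous.mul hec
  refine (memLp_two_iff_integrable_sq_norm hc.aestronglyMeasurable).2 ?_
  refine (hf.integrable_norm_sq one_pos).congr (ae_of_all _ fun z => ?_)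
  simp only [norm_mul, Complex.norm_real, Real.norm_eq_abs, Real.abs_exp]
  rw [mul_pow, ← Real.exp_nat_mul]
  push_cast
  ring_nf

end IsSubgaussian

/-! ### Gaussian moments -/

theorem integral_dA {E : Type*} [NormedAddCommGroup E] [NormedSpace ℝ E] (f : ℂ → E) :
    ∫ z, f z ∂dA = Real.pi⁻¹ • ∫ z, f z := by
  rw [dA, integral_smul_measure, ENNReal.toReal_ofReal (by positivity)]

theorem integral_dA_rotation {u : ℂ} (hu : ‖u‖ = 1) (f : ℂ → ℂ) :
    ∫ z, f (u * z) ∂dA = ∫ z, f z ∂dA := by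
  have h := (rotation ⟨u, by simpa [Submonoid.unitSphere] using hu⟩ :
    ℂ ≃ₗᵢ[ℝ] ℂ).measurePreserving.integral_comp
      (rotation ⟨u, by simpa [Submonoid.unitSphere] using hu⟩).toHomeomorph.measurableEmbedding f
  rw [integral_dA, integral_dA, ← h]
  rfl

/-- Rotation invariance makes the mixed moments vanish, polar coordinates give the others. -/
theorem integral_gaussian_monomial (j k : ℕ) :
    ∫ z : ℂ, z ^ j * conj z ^ k * (Real.exp (-1 * ‖z‖ ^ 2) : ℂ) ∂dA =
      if j = k then (k.factorial : ℂ) else 0 := by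
  split_ifs with h
  · subst h
    have h1 : ∀ z : ℂ, z ^ j * conj z ^ j * (Real.exp (-1 * ‖z‖ ^ 2) : ℂ) =
        ((‖z‖ ^ ((2 * j : ℕ) : ℝ) * Real.exp (-‖z‖ ^ (2 : ℝ)) : ℝ) : ℂ) := by
      intro z
      rw [← mul_pow, Complex.mul_conj, Complex.normSq_eq_norm_sq, Real.rpow_natCast,
        Real.rpow_two, pow_mul]
      push_cast
      ring_nf
    simp only [h1]
    rw [integral_complex_ofReal, integral_dA,
      Complex.integral_rpow_mul_exp_neg_rpow one_le_two
        (by have : (0 : ℝ) ≤ ((2 * j : ℕ) : ℝ) := by positivity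
            linarith)]
    have h2 : (((2 * j : ℕ) : ℝ) + 2) / 2 = j + 1 := by
      push_cast
      ring
    rw [h2, Real.Gamma_nat_eq_factorial]
    have := Real.pi_pos
    rw [smul_eq_mul]
    have h3 : Real.pi⁻¹ * (2 * Real.pi / 2 * (j.factorial : ℝ)) = j.factorial := by
      field_simp
    rw [h3]
    simp
  · have hjk : ((j : ℂ) - k) ≠ 0 := sub_ne_zero.2 (by exact_mod_cast h)
    -- the rotation by `π / (j - k)` changes the sign of the integrand
    obtain ⟨t, ht⟩ : ∃ t : ℝ, t = Real.pi / ((j : ℝ) - k) := ⟨_, rfl⟩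
    have hu : ‖Complex.exp (t * Complex.I)‖ = 1 := Complex.norm_exp_ofReal_mul_I t
    have h1 := integral_dA_rotation hu
      (fun z => z ^ j * conj z ^ k * (Real.exp (-1 * ‖z‖ ^ 2) : ℂ))
    have h2 : Complex.exp (t * Complex.I) ^ j * conj (Complex.exp (t * Complex.I)) ^ k = -1 := by
      rw [← Complex.exp_conj, ← Complex.exp_nat_mul, ← Complex.exp_nat_mul, ← Complex.exp_add,
        ← Complex.exp_pi_mul_I]
      congr 1
      simp only [map_mul, Complex.conj_ofReal, Complex.conj_I, ht]
      push_cast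
      field_simp
      ring
    have h3 : ∀ z : ℂ, (Complex.exp (t * Complex.I) * z) ^ j *
        conj (Complex.exp (t * Complex.I) * z) ^ k *
          (Real.exp (-1 * ‖Complex.exp (t * Complex.I) * z‖ ^ 2) : ℂ) =
        -(z ^ j * conj z ^ k * (Real.exp (-1 * ‖z‖ ^ 2) : ℂ)) := by
      intro z
      rw [norm_mul, hu, one_mul, map_mul, mul_pow, mul_pow, mul_mul_mul_comm, h2]
      ring
    simp only [h3] at h1
    rw [integral_neg] at h1
    exact self_eq_neg.1 h1.symm

theorem monomial_mem_Pol {n q j k : ℕ} (hj : j < n) (hk : k < q) :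
    (fun z : ℂ => z ^ j * conj z ^ k) ∈ Pol n q :=
  Submodule.subset_span ⟨j, hj, k, hk, rfl⟩

/-- In the power series expansion of `exp (c z)` only the term of index `k - j` contributes, and
none if `j > k`. In the latter case the right-hand side vanishes because `descFactorial` does. -/
theorem integral_gaussian_monomial_mul_exp (j k : ℕ) (c : ℂ) :
    ∫ z : ℂ, z ^ j * conj z ^ k * Complex.exp (c * z) * (Real.exp (-1 * ‖z‖ ^ 2) : ℂ) ∂dA =
      k.descFactorial j * c ^ (k - j) := by
  have hexp : ∀ x : ℂ, HasSum (fun l : ℕ => x ^ l / l.factorial) (Complex.exp x) := by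
    intro x
    rw [Complex.exp_eq_exp_ℂ]
    exact NormedSpace.expSeries_div_hasSum_exp x
  have hexpR : ∀ x : ℝ, HasSum (fun l : ℕ => x ^ l / l.factorial) (Real.exp x) := by
    intro x
    rw [Real.exp_eq_exp_ℝ]
    exact NormedSpace.expSeries_div_hasSum_exp x
  have hec : Continuous fun z : ℂ => (Real.exp (-1 * ‖z‖ ^ 2) : ℂ) :=
    Complex.continuous_ofReal.comp (by fun_prop)
  have hmono : Continuous fun z : ℂ => z ^ j * conj z ^ k :=
    continuous_of_mem_Pol (monomial_mem_Pol j.lt_succ_self k.lt_succ_self)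
  have hb : ∀ z : ℂ, HasSum (fun l : ℕ => ‖z ^ j * conj z ^ k *
      ((c * z) ^ l / l.factorial) * (Real.exp (-1 * ‖z‖ ^ 2) : ℂ)‖)
      (‖z ^ j * conj z ^ k‖ * Real.exp (‖c‖ * ‖z‖) * Real.exp (-1 * ‖z‖ ^ 2)) := by
    intro z
    have h := ((hexpR (‖c‖ * ‖z‖)).mul_left ‖z ^ j * conj z ^ k‖).mul_right
      (Real.exp (-1 * ‖z‖ ^ 2))
    convert! h using 2 with l
    rw [norm_mul _ ((Real.exp _ : ℝ) : ℂ), norm_mul (z ^ j * conj z ^ k), norm_div, norm_pow,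
      norm_mul c, Complex.norm_natCast, Complex.norm_real, Real.norm_eq_abs, Real.abs_exp]
  have hsum := hasSum_integral_of_dominated_convergence (μ := dA)
    (F := fun (l : ℕ) (z : ℂ) => z ^ j * conj z ^ k *
      ((c * z) ^ l / l.factorial) * (Real.exp (-1 * ‖z‖ ^ 2) : ℂ))
    (f := fun z => z ^ j * conj z ^ k * Complex.exp (c * z) * (Real.exp (-1 * ‖z‖ ^ 2) : ℂ))
    (fun l z => ‖z ^ j * conj z ^ k *
      ((c * z) ^ l / l.factorial) * (Real.exp (-1 * ‖z‖ ^ 2) : ℂ)‖)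
    (fun l => Continuous.aestronglyMeasurable (by fun_prop))
    (fun l => ae_of_all _ fun z => le_rfl)
    (ae_of_all _ fun z => (hb z).summable)
    (by
      simp only [(hb _).tsum_eq]
      have h1 : IsSubgaussian fun z : ℂ => (Real.exp (‖c‖ * ‖z‖) : ℂ) :=
        .of_bound (b := ‖c‖) (Complex.continuous_ofReal.comp (by fun_prop)) fun z => by
          rw [Complex.norm_real, Real.norm_eq_abs, Real.abs_exp]
      refine (((IsSubgaussian.of_mem_Pol (monomial_mem_Pol j.lt_succ_self k.lt_succ_self)).mul
        h1).integrable one_pos).norm.congr (ae_of_all _ fun z => ?_)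
      simp only [norm_mul, Complex.norm_real, Real.norm_eq_abs, Real.abs_exp])
    (ae_of_all _ fun z => ((hexp (c * z)).mul_left _).mul_right _)
  have hterm : ∀ l : ℕ, ∫ z : ℂ, z ^ j * conj z ^ k *
      ((c * z) ^ l / l.factorial) * (Real.exp (-1 * ‖z‖ ^ 2) : ℂ) ∂dA =
      c ^ l / l.factorial * if j + l = k then (k.factorial : ℂ) else 0 := by
    intro l
    rw [← integral_gaussian_monomial, ← integral_const_mul]
    congr 1
    ext z
    ring
  simp only [hterm] at hsum
  refine hsum.unique ?_
  by_cases hjk : j ≤ k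
  · have h := hasSum_single (f := fun l : ℕ => c ^ l / l.factorial *
      if j + l = k then (k.factorial : ℂ) else 0) (k - j)
      fun l hl => by rw [if_neg (by omega), mul_zero]
    have h2 : (((k - j).factorial * k.descFactorial j : ℕ) : ℂ) = k.factorial := by
      rw [Nat.factorial_mul_descFactorial hjk]
    convert! h using 1
    rw [if_pos (by omega), ← h2]
    push_cast
    have : ((k - j).factorial : ℂ) ≠ 0 := by exact_mod_cast (k - j).factorial_ne_zero
    field_simp
  · rw [Nat.descFactorial_eq_zero_iff_lt.2 (by omega)]
    convert! hasSum_zero using 2 with l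
    · rw [if_neg (by omega), mul_zero]
    · simp

/-! ### Spaces of polyanalytic polynomials -/

theorem Pol_mono {n n' : ℕ} (h : n ≤ n') (q : ℕ) : Pol n q ≤ Pol n' q :=
  Submodule.span_mono fun _ ⟨j, hj, k, hk, hf⟩ => ⟨j, hj.trans_le h, k, hk, hf⟩

theorem mem_Pol_comp_affine {n q : ℕ} {f : ℂ → ℂ} (hf : f ∈ Pol n q) (b d : ℂ) :
    (fun z => f (b * z + d)) ∈ Pol n q := by
  induction hf using Submodule.span_induction with
  | mem f hf =>
    obtain ⟨j, hj, k, hk, rfl⟩ := hf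
    have h : (fun z : ℂ => (b * z + d) ^ j * conj (b * z + d) ^ k) =
        ∑ i ∈ Finset.range (j + 1), ∑ l ∈ Finset.range (k + 1),
          (b ^ i * d ^ (j - i) * j.choose i * (conj b ^ l * conj d ^ (k - l) * k.choose l)) •
            fun z : ℂ => z ^ i * conj z ^ l := by
      ext z
      simp only [map_add, map_mul, add_pow, Finset.sum_mul_sum, Finset.sum_apply, Pi.smul_apply,
        smul_eq_mul]
      refine Finset.sum_congr rfl fun i _ => Finset.sum_congr rfl fun l _ => ?_
      ring
    rw [h]
    refine Submodule.sum_mem _ fun i hi => Submodule.sum_mem _ fun l hl =>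
      Submodule.smul_mem _ _ (monomial_mem_Pol ?_ ?_)
    · have := Finset.mem_range.1 hi
      omega
    · have := Finset.mem_range.1 hl
      omega
  | zero => exact Submodule.zero_mem _
  | add f g _ _ hf hg => exact Submodule.add_mem _ hf hg
  | smul a f _ hf => exact Submodule.smul_mem _ a hf

theorem pow_mul_mem_Pol {n q : ℕ} {f : ℂ → ℂ} (hf : f ∈ Pol n q) (i : ℕ) :
    (fun z => z ^ i * f z) ∈ Pol (n + i) q := by
  induction hf using Submodule.span_induction with
  | mem f hf =>
    obtain ⟨j, hj, k, hk, rfl⟩ := hf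
    have h : (fun z : ℂ => z ^ i * (z ^ j * conj z ^ k)) = fun z => z ^ (j + i) * conj z ^ k := by
      ext z
      ring
    rw [h]
    exact monomial_mem_Pol (by omega) hk
  | zero =>
    simp only [Pi.zero_apply, mul_zero]
    exact Submodule.zero_mem _
  | add f g _ _ hf hg =>
    simp only [Pi.add_apply, mul_add]
    exact Submodule.add_mem _ hf hg
  | smul a f _ hf =>
    simp only [Pi.smul_apply, smul_eq_mul, mul_left_comm _ a]
    exact Submodule.smul_mem _ a hf

theorem laguerre_norm_sq {q : ℕ} (hq : 1 ≤ q) (z : ℂ) :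
    (laguerre 1 (q - 1) (‖z‖ ^ 2) : ℂ) =
      ∑ i ∈ Finset.range q, (laguerreCoeff q i : ℂ) * (z ^ i * conj z ^ i) := by
  rw [laguerre_one_eq_sum hq]
  push_cast
  refine Finset.sum_congr rfl fun i _ => ?_
  rw [← mul_pow z, Complex.mul_conj, Complex.normSq_eq_norm_sq]
  push_cast
  ring

theorem laguerre_mem_Pol {q : ℕ} (hq : 1 ≤ q) :
    (fun z : ℂ => (laguerre 1 (q - 1) (‖z‖ ^ 2) : ℂ)) ∈ Pol q q := by
  have h : (fun z : ℂ => (laguerre 1 (q - 1) (‖z‖ ^ 2) : ℂ)) =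
      ∑ i ∈ Finset.range q, (laguerreCoeff q i : ℂ) • fun z : ℂ => z ^ i * conj z ^ i := by
    ext z
    simp only [laguerre_norm_sq hq, Finset.sum_apply, Pi.smul_apply, smul_eq_mul]
  rw [h]
  exact Submodule.sum_mem _ fun i hi => Submodule.smul_mem _ _
    (monomial_mem_Pol (Finset.mem_range.1 hi) (Finset.mem_range.1 hi))

/-- The function `L^1_{q-1}(|z|²)` reproduces the value at the origin of `q`-analytic functions
in the Fock space with weight `exp (-|z|²)`. -/
theorem integral_mul_exp_mul_laguerre {n q : ℕ} (hq : 1 ≤ q) {f : ℂ → ℂ} (hf : f ∈ Pol n q)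
    (c : ℂ) :
    ∫ z, f z * Complex.exp (c * z) * (laguerre 1 (q - 1) (‖z‖ ^ 2) : ℂ) *
      (Real.exp (-1 * ‖z‖ ^ 2) : ℂ) ∂dA = f 0 := by
  have hint : ∀ g ∈ Pol n q, Integrable (fun z => g z * Complex.exp (c * z) *
      (laguerre 1 (q - 1) (‖z‖ ^ 2) : ℂ) * (Real.exp (-1 * ‖z‖ ^ 2) : ℂ)) dA := fun g hg =>
    (((IsSubgaussian.of_mem_Pol hg).mul (.exp_mul c)).mul
      (.of_mem_Pol (laguerre_mem_Pol hq))).integrable one_pos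
  induction hf using Submodule.span_induction with
  | mem f hf =>
    obtain ⟨j, hj, k, hk, rfl⟩ := hf
    have h1 : ∀ z : ℂ, z ^ j * conj z ^ k * Complex.exp (c * z) *
        (laguerre 1 (q - 1) (‖z‖ ^ 2) : ℂ) * (Real.exp (-1 * ‖z‖ ^ 2) : ℂ) =
        ∑ i ∈ Finset.range q, (laguerreCoeff q i : ℂ) * (z ^ (j + i) * conj z ^ (k + i) *
          Complex.exp (c * z) * (Real.exp (-1 * ‖z‖ ^ 2) : ℂ)) := by
      intro z
      rw [laguerre_norm_sq hq, Finset.mul_sum, Finset.sum_mul]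
      refine Finset.sum_congr rfl fun i _ => ?_
      ring
    simp only [h1]
    rw [integral_finsetSum _ fun i _ => (((IsSubgaussian.of_mem_Pol
      (monomial_mem_Pol (j + i).lt_succ_self (k + i).lt_succ_self)).mul
        (.exp_mul c)).integrable one_pos).const_mul _]
    simp only [integral_const_mul, integral_gaussian_monomial_mul_exp]
    by_cases hjk : j ≤ k
    · have h2 : ∀ i ∈ Finset.range q, (laguerreCoeff q i : ℂ) *
          (((k + i).descFactorial (j + i) : ℂ) * c ^ (k + i - (j + i))) =
          c ^ (k - j) / (k - j).factorial *
            ((laguerreCoeff q i * (k + i).factorial : ℝ) : ℂ) := by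
        intro i _
        have h3 : (((k - j).factorial * (k + i).descFactorial (j + i) : ℕ) : ℂ) =
            (k + i).factorial := by
          rw [← Nat.factorial_mul_descFactorial (Nat.add_le_add_right hjk i),
            Nat.add_sub_add_right]
        have : ((k - j).factorial : ℂ) ≠ 0 := by exact_mod_cast (k - j).factorial_ne_zero
        push_cast at h3 ⊢
        rw [← h3, Nat.add_sub_add_right]
        field_simp
      rw [Finset.sum_congr rfl h2, ← Finset.mul_sum, ← Complex.ofReal_sum,
        sum_laguerreCoeff_mul_factorial hk]
      split_ifs with h0
      · subst h0
        obtain rfl : j = 0 := by omega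
        simp
      · simp [h0]
    · rw [Finset.sum_eq_zero fun i _ => ?_]
      · have : j ≠ 0 := by omega
        simp [this]
      · rw [Nat.descFactorial_eq_zero_iff_lt.2 (by omega)]
        simp
  | zero => simp
  | add f g hf hg ihf ihg =>
    simp only [Pi.add_apply, add_mul]
    rw [integral_add (hint f hf) (hint g hg), ihf, ihg]
  | smul a f _ hf =>
    simp only [Pi.smul_apply, smul_eq_mul, mul_assoc] at hf ⊢
    rw [integral_const_mul, hf]

theorem integral_laguerre_sq {q : ℕ} (hq : 1 ≤ q) :
    ∫ z : ℂ, laguerre 1 (q - 1) (‖z‖ ^ 2) ^ 2 * Real.exp (-1 * ‖z‖ ^ 2) ∂dA = q := by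
  have h := integral_mul_exp_mul_laguerre hq (laguerre_mem_Pol hq) 0
  have h1 : ∀ z : ℂ, (laguerre 1 (q - 1) (‖z‖ ^ 2) : ℂ) * Complex.exp (0 * z) *
      (laguerre 1 (q - 1) (‖z‖ ^ 2) : ℂ) * (Real.exp (-1 * ‖z‖ ^ 2) : ℂ) =
      ((laguerre 1 (q - 1) (‖z‖ ^ 2) ^ 2 * Real.exp (-1 * ‖z‖ ^ 2) : ℝ) : ℂ) := by
    intro z
    push_cast
    rw [zero_mul, Complex.exp_zero]
    ring
  simp only [h1] at h
  rw [integral_complex_ofReal, norm_zero, zero_pow two_ne_zero, laguerre_one_zero hq] at h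
  exact_mod_cast h

/-! ### Approximate orthogonal projections in `L²` -/

section L2

variable {X : Type*} [MeasurableSpace X] {μ : Measure X} {f g k l T : X → ℂ}

theorem integrable_mul_conj (hf : MemLp f 2 μ) (hg : MemLp g 2 μ) :
    Integrable (fun x => f x * conj (g x)) μ :=
  hf.integrable_mul hg.star

theorem integrable_norm_sq_of_memLp (hf : MemLp f 2 μ) : Integrable (fun x => ‖f x‖ ^ 2) μ :=
  (memLp_two_iff_integrable_sq_norm hf.1).1 hf

theorem integral_norm_sub_sq (hf : MemLp f 2 μ) (hg : MemLp g 2 μ) :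
    ∫ x, ‖f x - g x‖ ^ 2 ∂μ =
      ∫ x, ‖f x‖ ^ 2 ∂μ - 2 * (∫ x, f x * conj (g x) ∂μ).re + ∫ x, ‖g x‖ ^ 2 ∂μ := by
  have hfg := integrable_mul_conj hf hg
  have h1 : ∀ x, ‖f x - g x‖ ^ 2 =
      ‖f x‖ ^ 2 - 2 * RCLike.re (f x * conj (g x)) + ‖g x‖ ^ 2 := by
    intro x
    rw [← Complex.normSq_eq_norm_sq, Complex.normSq_sub, Complex.normSq_eq_norm_sq,
      Complex.normSq_eq_norm_sq]
    simp only [RCLike.re_to_complex]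
    ring
  simp only [h1]
  have h2 := hfg.re
  have h3 : Integrable (fun x => ‖f x‖ ^ 2 - 2 * RCLike.re (f x * conj (g x))) μ :=
    (integrable_norm_sq_of_memLp hf).sub (h2.const_mul 2)
  rw [integral_add h3 (integrable_norm_sq_of_memLp hg), integral_sub (integrable_norm_sq_of_memLp hf)
    (h2.const_mul 2), integral_const_mul, integral_re hfg]
  rfl

/-- The hypotheses say that `k` is the orthogonal projection of `l` to a space which contains `k`
and `T`, and that `‖k‖² = r`. The first conclusion is Pythagoras' theorem, and the second one
says that `k` is at least as close to `l` as `T` is. -/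
theorem integral_norm_sub_sq_projection (hk : MemLp k 2 μ) (hl : MemLp l 2 μ) (hT : MemLp T 2 μ)
    {r : ℝ} (hr : ∫ x, ‖k x‖ ^ 2 ∂μ = r) (hkl : ∫ x, k x * conj (l x) ∂μ = r)
    (hTl : ∫ x, T x * conj (k x) ∂μ = ∫ x, T x * conj (l x) ∂μ) :
    ∫ x, ‖k x - l x‖ ^ 2 ∂μ = ∫ x, ‖l x‖ ^ 2 ∂μ - r ∧
      ∫ x, ‖l x‖ ^ 2 ∂μ - r ≤ ∫ x, ‖T x - l x‖ ^ 2 ∂μ := by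
  have h1 := integral_norm_sub_sq hT hk
  have h2 : 0 ≤ ∫ x, ‖T x - k x‖ ^ 2 ∂μ := integral_nonneg fun x => by positivity
  rw [integral_norm_sub_sq hk hl, integral_norm_sub_sq hT hl, hkl, hr, Complex.ofReal_re]
  rw [hTl] at h1
  constructor <;> linarith

theorem abs_norm_sq_sub_norm_sq_le (x y : ℂ) {t : ℝ} (ht : 0 < t) :
    |‖x‖ ^ 2 - ‖y‖ ^ 2| ≤ (1 + t⁻¹) * ‖x - y‖ ^ 2 + t * ‖y‖ ^ 2 := by
  have h1 : |‖x‖ - ‖y‖| ≤ ‖x - y‖ := abs_norm_sub_norm_le x y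
  have h2 : ‖x‖ + ‖y‖ ≤ ‖x - y‖ + 2 * ‖y‖ := by linarith [(abs_le.1 h1).2]
  have h3 : 0 ≤ t⁻¹ * (‖x - y‖ - t * ‖y‖) ^ 2 := by positivity
  have h4 : t⁻¹ * (‖x - y‖ - t * ‖y‖) ^ 2 =
      t⁻¹ * ‖x - y‖ ^ 2 - 2 * ‖x - y‖ * ‖y‖ + t * ‖y‖ ^ 2 := by
    field_simp
    ring
  rw [sq_sub_sq, abs_mul, abs_of_nonneg (by positivity)]
  calc (‖x‖ + ‖y‖) * |‖x‖ - ‖y‖| ≤ (‖x - y‖ + 2 * ‖y‖) * ‖x - y‖ := by gcongr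
    _ ≤ _ := by nlinarith

/-- If the norms of `k` and of `k - l` are related by Pythagoras' theorem, then the normalized
densities of `k` and `l` are close in `L¹` when `‖k‖² = r` is close to `‖l‖² = s`. -/
theorem integral_abs_density_sub_le (hk : MemLp k 2 μ) (hl : MemLp l 2 μ) {r s t : ℝ}
    (ht : 0 < t) (hr0 : 0 < r) (hs0 : 0 < s) (hr : ∫ x, ‖k x‖ ^ 2 ∂μ = r)
    (hs : ∫ x, ‖l x‖ ^ 2 ∂μ = s) (hkl : ∫ x, ‖k x - l x‖ ^ 2 ∂μ = s - r) :
    ∫ x, |‖k x‖ ^ 2 / r - ‖l x‖ ^ 2 / s| ∂μ ≤ (2 + t⁻¹) * ((s - r) / s) + t := by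
  have hrs : r ≤ s := by
    have : 0 ≤ ∫ x, ‖k x - l x‖ ^ 2 ∂μ := integral_nonneg fun x => by positivity
    linarith
  have hik := integrable_norm_sq_of_memLp hk
  have hil := integrable_norm_sq_of_memLp hl
  have hikl : Integrable (fun x => ‖k x - l x‖ ^ 2) μ := integrable_norm_sq_of_memLp (hk.sub hl)
  have hpt : ∀ x, |‖k x‖ ^ 2 / r - ‖l x‖ ^ 2 / s| ≤
      (r⁻¹ - s⁻¹) * ‖k x‖ ^ 2 +
        ((1 + t⁻¹) * s⁻¹ * ‖k x - l x‖ ^ 2 + t * s⁻¹ * ‖l x‖ ^ 2) := by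
    intro x
    have h1 : ‖k x‖ ^ 2 / r - ‖l x‖ ^ 2 / s =
        (r⁻¹ - s⁻¹) * ‖k x‖ ^ 2 + s⁻¹ * (‖k x‖ ^ 2 - ‖l x‖ ^ 2) := by ring
    have h2 : 0 ≤ (r⁻¹ - s⁻¹) * ‖k x‖ ^ 2 :=
      mul_nonneg (sub_nonneg.2 (inv_anti₀ hr0 hrs)) (by positivity)
    have h3 := abs_norm_sq_sub_norm_sq_le (k x) (l x) ht
    rw [h1]
    refine (abs_add_le _ _).trans ?_
    rw [abs_of_nonneg h2, abs_mul, abs_of_pos (inv_pos.2 hs0)]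
    have h4 := mul_le_mul_of_nonneg_left h3 (inv_pos.2 hs0).le
    linarith
  have hi1 := hik.const_mul (r⁻¹ - s⁻¹)
  have hi2 := hikl.const_mul ((1 + t⁻¹) * s⁻¹)
  have hi3 := hil.const_mul (t * s⁻¹)
  calc ∫ x, |‖k x‖ ^ 2 / r - ‖l x‖ ^ 2 / s| ∂μ
      ≤ ∫ x, ((r⁻¹ - s⁻¹) * ‖k x‖ ^ 2 +
        ((1 + t⁻¹) * s⁻¹ * ‖k x - l x‖ ^ 2 + t * s⁻¹ * ‖l x‖ ^ 2)) ∂μ :=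
        integral_mono ((hik.div_const r).sub (hil.div_const s)).abs (hi1.add (hi2.add hi3)) hpt
    _ = (r⁻¹ - s⁻¹) * r + ((1 + t⁻¹) * s⁻¹ * (s - r) + t * s⁻¹ * s) := by
        have hadd := integral_add hi2 hi3
        have hadd' := integral_add hi1 (hi2.add hi3)
        simp only [Pi.add_apply] at hadd'
        rw [hadd', hadd, integral_const_mul, integral_const_mul, integral_const_mul, hr, hs, hkl]
    _ = _ := by
        field_simp
        ring

end L2

/-! ### The kernel in blow-up coordinates -/

theorem IsReproducingKernel.apply_eq_conj {m : ℝ} {V : Submodule ℂ (ℂ → ℂ)} {K : ℂ → ℂ → ℂ}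
    (h : IsReproducingKernel m V K) (a b : ℂ) : K a b = conj (K b a) := by
  have h1 := h.reproducing _ (h.mem b) a
  have h2 := h.reproducing _ (h.mem a) b
  rw [← h1, ← h2, ← integral_conj]
  congr 1
  ext z
  simp only [map_mul, Complex.conj_conj, Complex.conj_ofReal]
  ring

theorem IsReproducingKernel.ofReal_re_diag {m : ℝ} {V : Submodule ℂ (ℂ → ℂ)} {K : ℂ → ℂ → ℂ}
    (h : IsReproducingKernel m V K) (a : ℂ) : ((K a a).re : ℂ) = K a a :=
  Complex.conj_eq_iff_re.1 (h.apply_eq_conj a a).symm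

/-- The point with blow-up coordinate `ξ` around `a` at the scale `m ^ {-1/2}`. -/
noncomputable def blowupPoint (m : ℝ) (a ξ : ℂ) : ℂ := a + (((Real.sqrt m)⁻¹ : ℝ) : ℂ) * ξ

theorem integral_comp_blowupPoint {E : Type*} [NormedAddCommGroup E] [NormedSpace ℝ E] {m : ℝ}
    (hm : 0 < m) (a : ℂ) (F : ℂ → E) :
    ∫ ξ, F (blowupPoint m a ξ) ∂dA = m • ∫ w, F w ∂dA := by
  have h1 : ∀ ξ, F (blowupPoint m a ξ) = (fun w => F (a + w)) ((Real.sqrt m)⁻¹ • ξ) := by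
    intro ξ
    simp only [blowupPoint, Complex.real_smul]
  simp only [h1]
  rw [integral_dA, integral_dA, Measure.integral_comp_inv_smul_of_nonneg volume
    (fun w => F (a + w)) (Real.sqrt_nonneg m), Complex.finrank_real_complex,
    Real.sq_sqrt hm.le, integral_add_left_eq_self F a, smul_comm]

theorem mul_norm_blowupPoint_sq {m : ℝ} (hm : 0 < m) (a ξ : ℂ) :
    m * ‖blowupPoint m a ξ‖ ^ 2 =
      m * ‖a‖ ^ 2 + 2 * ((Real.sqrt m : ℂ) * conj a * ξ).re + ‖ξ‖ ^ 2 := by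
  have hs : Real.sqrt m ≠ 0 := (Real.sqrt_pos.2 hm).ne'
  have hm2 : m = Real.sqrt m ^ 2 := (Real.sq_sqrt hm.le).symm
  have h1 : (blowupPoint m a ξ).re = a.re + (Real.sqrt m)⁻¹ * ξ.re := by
    simp [blowupPoint, Complex.add_re, -Complex.ofReal_inv]
  have h2 : (blowupPoint m a ξ).im = a.im + (Real.sqrt m)⁻¹ * ξ.im := by
    simp [blowupPoint, Complex.add_im, -Complex.ofReal_inv]
  have h3 : ((Real.sqrt m : ℂ) * conj a * ξ).re = Real.sqrt m * (a.re * ξ.re + a.im * ξ.im) := by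
    rw [mul_assoc, Complex.re_ofReal_mul]
    simp
  rw [← Complex.normSq_eq_norm_sq, ← Complex.normSq_eq_norm_sq, ← Complex.normSq_eq_norm_sq,
    Complex.normSq_apply, Complex.normSq_apply, Complex.normSq_apply, h1, h2, h3]
  generalize Real.sqrt m = σ at *
  rw [hm2]
  field_simp
  ring

/-- A function in blow-up coordinates around `a`. The exponential factor is chosen such that the
weight becomes `exp (-|ξ|²)`, see `norm_blowupTransform_sq`. -/
noncomputable def blowupTransform (m : ℝ) (a : ℂ) (f : ℂ → ℂ) (ξ : ℂ) : ℂ :=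
  f (blowupPoint m a ξ) * Complex.exp (-((Real.sqrt m : ℂ) * conj a) * ξ)

theorem blowupTransform_mul_conj {m : ℝ} (hm : 0 < m) (a : ℂ) (f g : ℂ → ℂ) (ξ : ℂ) :
    blowupTransform m a f ξ * conj (blowupTransform m a g ξ) * (Real.exp (-1 * ‖ξ‖ ^ 2) : ℂ) =
      (Real.exp (m * ‖a‖ ^ 2) : ℂ) * (f (blowupPoint m a ξ) * conj (g (blowupPoint m a ξ)) *
        (Real.exp (-m * ‖blowupPoint m a ξ‖ ^ 2) : ℂ)) := by
  have h : Complex.exp (-((Real.sqrt m : ℂ) * conj a) * ξ) *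
      conj (Complex.exp (-((Real.sqrt m : ℂ) * conj a) * ξ)) * (Real.exp (-1 * ‖ξ‖ ^ 2) : ℂ) =
      (Real.exp (m * ‖a‖ ^ 2) : ℂ) * (Real.exp (-m * ‖blowupPoint m a ξ‖ ^ 2) : ℂ) := by
    rw [Complex.mul_conj, Complex.normSq_eq_norm_sq, Complex.norm_exp, ← Real.exp_nat_mul,
      ← Complex.ofReal_mul, ← Complex.ofReal_mul, ← Real.exp_add, ← Real.exp_add, neg_mul m,
      mul_norm_blowupPoint_sq hm, neg_mul ((Real.sqrt m : ℂ) * conj a), Complex.neg_re]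
    push_cast
    ring_nf
  rw [blowupTransform, blowupTransform, map_mul]
  linear_combination (f (blowupPoint m a ξ) * conj (g (blowupPoint m a ξ))) * h

theorem norm_blowupTransform_sq {m : ℝ} (hm : 0 < m) (a : ℂ) (f : ℂ → ℂ) (ξ : ℂ) :
    ‖blowupTransform m a f ξ‖ ^ 2 * Real.exp (-1 * ‖ξ‖ ^ 2) =
      Real.exp (m * ‖a‖ ^ 2) * (‖f (blowupPoint m a ξ)‖ ^ 2 *
        Real.exp (-m * ‖blowupPoint m a ξ‖ ^ 2)) := by
  have h := blowupTransform_mul_conj hm a f f ξ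
  rw [Complex.mul_conj, Complex.mul_conj, Complex.normSq_eq_norm_sq,
    Complex.normSq_eq_norm_sq] at h
  exact_mod_cast h

theorem comp_blowupPoint_mem_Pol {n q : ℕ} {f : ℂ → ℂ} (hf : f ∈ Pol n q) (m : ℝ) (a : ℂ) :
    (fun ξ => f (blowupPoint m a ξ)) ∈ Pol n q := by
  have h := mem_Pol_comp_affine hf (((Real.sqrt m)⁻¹ : ℝ) : ℂ) a
  simpa only [blowupPoint, add_comm a] using h

theorem isSubgaussian_blowupTransform {n q : ℕ} {f : ℂ → ℂ} (hf : f ∈ Pol n q) (m : ℝ) (a : ℂ) :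
    IsSubgaussian (blowupTransform m a f) :=
  (IsSubgaussian.of_mem_Pol (comp_blowupPoint_mem_Pol hf m a)).mul (.exp_mul _)

theorem blowupPoint_zero (m : ℝ) (a : ℂ) : blowupPoint m a 0 = a := by simp [blowupPoint]

theorem integral_blowupTransform_mul_laguerre {n q : ℕ} (hq : 1 ≤ q) {f : ℂ → ℂ}
    (hf : f ∈ Pol n q) (m : ℝ) (a : ℂ) :
    ∫ ξ, blowupTransform m a f ξ * (laguerre 1 (q - 1) (‖ξ‖ ^ 2) : ℂ) *
      (Real.exp (-1 * ‖ξ‖ ^ 2) : ℂ) ∂dA = f a := by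
  have h := integral_mul_exp_mul_laguerre hq (comp_blowupPoint_mem_Pol hf m a)
    (-((Real.sqrt m : ℂ) * conj a))
  rwa [blowupPoint_zero] at h

/-- The kernel `K_{m,n,q}(·, a)` in blow-up coordinates, divided by `m exp (m |a|²)`. It converges
to `L^1_{q-1}(|ξ|²)`, the corresponding kernel of the space of all `q`-analytic functions. -/
noncomputable def blowupKernel (m : ℝ) (n q : ℕ) (a : ℂ) : ℂ → ℂ :=
  blowupTransform m a
    (((m * Real.exp (m * ‖a‖ ^ 2))⁻¹ : ℝ) • fun w => polyKernel m n q w a)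

/-- The value of `blowupKernel` at the origin, see `integral_norm_blowupKernel_sq`. -/
noncomputable def blowupDiag (m : ℝ) (n q : ℕ) (a : ℂ) : ℝ :=
  (m * Real.exp (m * ‖a‖ ^ 2))⁻¹ * (polyKernel m n q a a).re

section kernel

variable {m : ℝ} {n q : ℕ}

theorem smul_polyKernel_mem_Pol (hm : 0 < m) (a : ℂ) (b : ℝ) :
    (b • fun w => polyKernel m n q w a) ∈ Pol n q :=
  Submodule.smul_of_tower_mem _ b ((isReproducingKernel_polyKernel hm n q).mem a)

theorem isSubgaussian_blowupKernel (hm : 0 < m) (a : ℂ) :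
    IsSubgaussian (blowupKernel m n q a) :=
  isSubgaussian_blowupTransform (smul_polyKernel_mem_Pol hm a _) m a

theorem integral_blowupTransform_mul_blowupKernel (hm : 0 < m) {f : ℂ → ℂ} (hf : f ∈ Pol n q)
    (a : ℂ) :
    ∫ ξ, blowupTransform m a f ξ * conj (blowupKernel m n q a ξ) *
      (Real.exp (-1 * ‖ξ‖ ^ 2) : ℂ) ∂dA = f a := by
  have h := (isReproducingKernel_polyKernel hm n q).reproducing f hf a
  have he := Real.exp_pos (m * ‖a‖ ^ 2)
  simp only [blowupKernel, blowupTransform_mul_conj hm]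
  rw [integral_const_mul, integral_comp_blowupPoint hm a fun w => f w *
    conj ((((m * Real.exp (m * ‖a‖ ^ 2))⁻¹ : ℝ) • fun w => polyKernel m n q w a) w) *
      (Real.exp (-m * ‖w‖ ^ 2) : ℂ)]
  have h1 : ∀ w, f w *
      conj ((((m * Real.exp (m * ‖a‖ ^ 2))⁻¹ : ℝ) • fun w => polyKernel m n q w a) w) *
      (Real.exp (-m * ‖w‖ ^ 2) : ℂ) = (((m * Real.exp (m * ‖a‖ ^ 2))⁻¹ : ℝ) : ℂ) *
        (f w * conj (polyKernel m n q w a) * (Real.exp (-m * ‖w‖ ^ 2) : ℂ)) := by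
    intro w
    rw [Pi.smul_apply, Complex.real_smul, map_mul, Complex.conj_ofReal]
    ring
  simp only [h1]
  rw [integral_const_mul, h, Complex.real_smul, ← mul_assoc, ← mul_assoc, ← Complex.ofReal_mul,
    ← Complex.ofReal_mul]
  have h2 : Real.exp (m * ‖a‖ ^ 2) * m * (m * Real.exp (m * ‖a‖ ^ 2))⁻¹ = 1 := by
    field_simp
  rw [h2, Complex.ofReal_one, one_mul]

theorem smul_polyKernel_diag (hm : 0 < m) (a : ℂ) :
    (((m * Real.exp (m * ‖a‖ ^ 2))⁻¹ : ℝ) • fun w => polyKernel m n q w a) a =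
      blowupDiag m n q a := by
  rw [blowupDiag, Pi.smul_apply, Complex.real_smul, Complex.ofReal_mul,
    (isReproducingKernel_polyKernel hm n q).ofReal_re_diag]

theorem integral_norm_blowupKernel_sq (hm : 0 < m) (a : ℂ) :
    ∫ ξ, ‖blowupKernel m n q a ξ‖ ^ 2 * Real.exp (-1 * ‖ξ‖ ^ 2) ∂dA = blowupDiag m n q a := by
  have h := integral_blowupTransform_mul_blowupKernel (q := q) (n := n) hm
    (smul_polyKernel_mem_Pol hm a (m * Real.exp (m * ‖a‖ ^ 2))⁻¹) a
  rw [smul_polyKernel_diag hm] at h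
  have h1 : ∀ ξ, blowupTransform m a
      (((m * Real.exp (m * ‖a‖ ^ 2))⁻¹ : ℝ) • fun w => polyKernel m n q w a) ξ *
      conj (blowupKernel m n q a ξ) * (Real.exp (-1 * ‖ξ‖ ^ 2) : ℂ) =
      ((‖blowupKernel m n q a ξ‖ ^ 2 * Real.exp (-1 * ‖ξ‖ ^ 2) : ℝ) : ℂ) := by
    intro ξ
    rw [← blowupKernel, Complex.mul_conj, Complex.normSq_eq_norm_sq]
    push_cast
    rfl
  simp only [h1] at h
  rw [integral_complex_ofReal] at h
  exact_mod_cast h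

theorem blowupBerezinDensity_eq (hm : 0 < m) (a ξ : ℂ) :
    blowupBerezinDensity m n q a ξ =
      ‖blowupKernel m n q a ξ‖ ^ 2 * Real.exp (-1 * ‖ξ‖ ^ 2) / blowupDiag m n q a := by
  rw [blowupKernel, norm_blowupTransform_sq hm, blowupBerezinDensity, berezinDensity, blowupDiag,
    ← blowupPoint, (isReproducingKernel_polyKernel hm n q).apply_eq_conj a, RCLike.norm_conj,
    Pi.smul_apply, norm_smul, Real.norm_eq_abs, mul_pow, sq_abs]
  have he := Real.exp_pos (m * ‖a‖ ^ 2)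
  generalize Real.exp (m * ‖a‖ ^ 2) = E at *
  generalize (polyKernel m n q a a).re = D
  simp only [div_eq_mul_inv, mul_inv, inv_inv]
  generalize D⁻¹ = D'
  field_simp

theorem berezinDensity_eq (hm : 0 < m) (a w : ℂ) :
    berezinDensity m n q a w = (polyKernel m n q a a).re⁻¹ *
      (‖polyKernel m n q w a‖ ^ 2 * Real.exp (-m * ‖w‖ ^ 2)) := by
  rw [berezinDensity, (isReproducingKernel_polyKernel hm n q).apply_eq_conj a, RCLike.norm_conj]
  ring

theorem continuous_berezinDensity (hm : 0 < m) (a : ℂ) :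
    Continuous (berezinDensity m n q a) := by
  have h := continuous_of_mem_Pol ((isReproducingKernel_polyKernel hm n q).mem a)
  have h1 : berezinDensity m n q a = fun w => (polyKernel m n q a a).re⁻¹ *
      (‖polyKernel m n q w a‖ ^ 2 * Real.exp (-m * ‖w‖ ^ 2)) :=
    funext (berezinDensity_eq hm a)
  rw [h1]
  fun_prop

theorem integrable_berezinDensity (hm : 0 < m) (a : ℂ) :
    Integrable (berezinDensity m n q a) dA := by
  refine Integrable.congr (((IsSubgaussian.of_mem_Pol
    ((isReproducingKernel_polyKernel hm n q).mem a)).integrable_norm_sq hm).const_mul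
      (polyKernel m n q a a).re⁻¹) (ae_of_all _ fun w => ?_)
  exact (berezinDensity_eq hm a w).symm

theorem integral_berezinDensity (hm : 0 < m) {a : ℂ} (ha : (polyKernel m n q a a).re ≠ 0) :
    ∫ w, berezinDensity m n q a w ∂dA = 1 := by
  have hK := isReproducingKernel_polyKernel hm n q
  have h := hK.reproducing _ (hK.mem a) a
  have h1 : ∀ w, polyKernel m n q w a * conj (polyKernel m n q w a) *
      (Real.exp (-m * ‖w‖ ^ 2) : ℂ) =
      ((‖polyKernel m n q w a‖ ^ 2 * Real.exp (-m * ‖w‖ ^ 2) : ℝ) : ℂ) := by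
    intro w
    rw [Complex.mul_conj, Complex.normSq_eq_norm_sq]
    push_cast
    rfl
  simp only [h1] at h
  rw [integral_complex_ofReal, ← hK.ofReal_re_diag a] at h
  simp only [berezinDensity_eq hm]
  rw [integral_const_mul, Complex.ofReal_inj.1 h, inv_mul_cancel₀ ha]

theorem berezinDensity_nonneg {a : ℂ} (ha : 0 < (polyKernel m n q a a).re) (w : ℂ) :
    0 ≤ berezinDensity m n q a w := by
  rw [berezinDensity]
  positivity

theorem isProbabilityMeasure_berezinMeasure (hm : 0 < m) {a : ℂ}
    (ha : 0 < (polyKernel m n q a a).re) : IsProbabilityMeasure (berezinMeasure m n q a) := by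
  refine ⟨?_⟩
  rw [berezinMeasure, withDensity_apply _ MeasurableSet.univ, Measure.restrict_univ,
    ← ofReal_integral_eq_lintegral_ofReal (integrable_berezinDensity hm a)
      (ae_of_all _ (berezinDensity_nonneg ha)), integral_berezinDensity hm ha.ne',
    ENNReal.ofReal_one]

theorem integral_berezinMeasure (hm : 0 < m) {a : ℂ} (ha : 0 < (polyKernel m n q a a).re)
    (f : ℂ → ℝ) :
    ∫ w, f w ∂(berezinMeasure m n q a) =
      ∫ ξ, f (blowupPoint m a ξ) * blowupBerezinDensity m n q a ξ ∂dA := by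
  have h1 : ∀ ξ, f (blowupPoint m a ξ) * blowupBerezinDensity m n q a ξ =
      m⁻¹ * (fun w => berezinDensity m n q a w * f w) (blowupPoint m a ξ) := by
    intro ξ
    simp only [blowupBerezinDensity, ← blowupPoint.eq_1]
    ring
  simp only [h1]
  rw [integral_const_mul, integral_comp_blowupPoint hm a fun w => berezinDensity m n q a w * f w,
    smul_eq_mul, ← mul_assoc, inv_mul_cancel₀ hm.ne', one_mul, berezinMeasure,
    integral_withDensity_eq_integral_toReal_smul
      (continuous_berezinDensity hm a).measurable.ennreal_ofReal
      (ae_of_all _ fun w => ENNReal.ofReal_lt_top)]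
  congr 1
  ext w
  rw [ENNReal.toReal_ofReal (berezinDensity_nonneg ha w), smul_eq_mul]

end kernel

theorem limitDensity_eq (q : ℕ) (ξ : ℂ) :
    limitDensity q ξ = laguerre 1 (q - 1) (‖ξ‖ ^ 2) ^ 2 * Real.exp (-1 * ‖ξ‖ ^ 2) / q := by
  rw [limitDensity, neg_one_mul]
  ring

theorem integrable_limitDensity {q : ℕ} (hq : 1 ≤ q) : Integrable (limitDensity q) dA := by
  refine (((IsSubgaussian.of_mem_Pol (laguerre_mem_Pol hq)).integrable_norm_sq
    one_pos).div_const (q : ℝ)).congr (ae_of_all _ fun ξ => ?_)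
  simp only [limitDensity_eq, Complex.norm_real, Real.norm_eq_abs, sq_abs]

theorem integral_limitDensity {q : ℕ} (hq : 1 ≤ q) : ∫ ξ, limitDensity q ξ ∂dA = 1 := by
  simp only [limitDensity_eq]
  rw [integral_div, integral_laguerre_sq hq, div_self]
  exact_mod_cast (by omega : q ≠ 0)

/-- The distance in `L¹` between the blow-up Berezin density and its limit is controlled by the
distance in `L²` between the limit kernel and any element of the space. -/
theorem integral_abs_blowupBerezinDensity_sub_le {m : ℝ} (hm : 0 < m) {n q : ℕ} (hq : 1 ≤ q)
    (a : ℂ) {T : ℂ → ℂ} (hT : T ∈ Pol n q) {t : ℝ} (ht : 0 < t) {δ : ℝ} (hδ : δ < q)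
    (hd : ∫ ξ, ‖blowupTransform m a T ξ - (laguerre 1 (q - 1) (‖ξ‖ ^ 2) : ℂ)‖ ^ 2 *
      Real.exp (-1 * ‖ξ‖ ^ 2) ∂dA ≤ δ) :
    0 < (polyKernel m n q a a).re ∧
      ∫ ξ, |blowupBerezinDensity m n q a ξ - limitDensity q ξ| ∂dA ≤
        (2 + t⁻¹) * (δ / q) + t := by
  have hq0 : (0 : ℝ) < q := by exact_mod_cast hq
  have hL := (IsSubgaussian.of_mem_Pol (laguerre_mem_Pol hq)).memLp
  have hK := (isSubgaussian_blowupKernel (n := n) (q := q) hm a).memLp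
  have hTs := (isSubgaussian_blowupTransform hT m a).memLp
  have hg : ∀ ξ : ℂ, (Real.exp (-‖ξ‖ ^ 2 / 2) : ℂ) * (Real.exp (-‖ξ‖ ^ 2 / 2) : ℂ) =
      (Real.exp (-1 * ‖ξ‖ ^ 2) : ℂ) := by
    intro ξ
    rw [← Complex.ofReal_mul, ← Real.exp_add]
    ring_nf
  have hw : ∀ (x y ξ : ℂ), x * (Real.exp (-‖ξ‖ ^ 2 / 2) : ℂ) *
      conj (y * (Real.exp (-‖ξ‖ ^ 2 / 2) : ℂ)) =
      x * conj y * (Real.exp (-1 * ‖ξ‖ ^ 2) : ℂ) := by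
    intro x y ξ
    rw [map_mul, Complex.conj_ofReal, mul_mul_mul_comm, hg]
  have hn : ∀ (x ξ : ℂ), ‖x * (Real.exp (-‖ξ‖ ^ 2 / 2) : ℂ)‖ ^ 2 =
      ‖x‖ ^ 2 * Real.exp (-1 * ‖ξ‖ ^ 2) := by
    intro x ξ
    rw [norm_mul, mul_pow, Complex.norm_real, Real.norm_eq_abs, Real.abs_exp, ← Real.exp_nat_mul]
    push_cast
    ring_nf
  have hs : ∫ ξ : ℂ, ‖(laguerre 1 (q - 1) (‖ξ‖ ^ 2) : ℂ) *
      (Real.exp (-‖ξ‖ ^ 2 / 2) : ℂ)‖ ^ 2 ∂dA = q := by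
    simp only [hn, Complex.norm_real, Real.norm_eq_abs, sq_abs]
    exact integral_laguerre_sq hq
  have hr : ∫ ξ : ℂ, ‖blowupKernel m n q a ξ * (Real.exp (-‖ξ‖ ^ 2 / 2) : ℂ)‖ ^ 2 ∂dA =
      blowupDiag m n q a := by
    simp only [hn]
    exact integral_norm_blowupKernel_sq hm a
  have hproj := integral_norm_sub_sq_projection hK hL hTs hr
    (by
      simp only [hw, Complex.conj_ofReal]
      rw [← smul_polyKernel_diag hm]
      exact integral_blowupTransform_mul_laguerre hq (smul_polyKernel_mem_Pol hm a _) m a)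
    (by
      simp only [hw, Complex.conj_ofReal]
      rw [integral_blowupTransform_mul_blowupKernel hm hT,
        integral_blowupTransform_mul_laguerre hq hT])
  rw [hs] at hproj
  simp only [← sub_mul _ _ (Complex.ofReal _), hn] at hproj
  obtain ⟨hpyth, hle⟩ := hproj
  have hr0 : 0 < blowupDiag m n q a := by linarith
  refine ⟨?_, ?_⟩
  · rw [blowupDiag] at hr0
    exact pos_of_mul_pos_right hr0 (by positivity)
  · have h := integral_abs_density_sub_le hK hL ht hr0 hq0 hr hs
      (by simpa only [← sub_mul _ _ (Complex.ofReal _), hn] using hpyth)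
    simp only [hn, Complex.norm_real, Real.norm_eq_abs, sq_abs, ← blowupBerezinDensity_eq hm,
      ← limitDensity_eq] at h
    refine h.trans ?_
    gcongr
    linarith

/-! ### Truncation of the exponential series -/

theorem norm_exp_sub_sum_le_exp (x : ℂ) (N : ℕ) {b : ℝ} (hb : 0 ≤ b) :
    ‖Complex.exp x - ∑ j ∈ Finset.range N, x ^ j / j.factorial‖ ≤
      Real.exp (-(b * N)) * Real.exp (Real.exp b * ‖x‖) := by
  refine (Complex.norm_exp_sub_sum_le_exp_norm_sub_sum x N).trans ?_
  have hexp : ∀ y : ℝ, HasSum (fun j : ℕ => y ^ j / j.factorial) (Real.exp y) := by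
    intro y
    rw [Real.exp_eq_exp_ℝ]
    exact NormedSpace.expSeries_div_hasSum_exp y
  have hx := (hasSum_nat_add_iff' N).2 (hexp ‖x‖)
  have hbx := ((hasSum_nat_add_iff' N).2 (hexp (Real.exp b * ‖x‖))).mul_left
    (Real.exp (-(b * N)))
  refine (hasSum_le (fun j => ?_) hx hbx).trans ?_
  · have h1 : 1 ≤ Real.exp (-(b * N)) * Real.exp b ^ (j + N) := by
      rw [← Real.exp_nat_mul, ← Real.exp_add]
      refine Real.one_le_exp ?_
      have : 0 ≤ (j : ℝ) * b := by positivity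
      push_cast
      linarith
    have h2 : 0 ≤ ‖x‖ ^ (j + N) / ((j + N).factorial : ℝ) := by positivity
    rw [mul_pow]
    calc _ ≤ Real.exp (-(b * N)) * Real.exp b ^ (j + N) *
          (‖x‖ ^ (j + N) / ((j + N).factorial : ℝ)) := le_mul_of_one_le_left h2 h1
      _ = _ := by ring
  · have h3 : 0 ≤ ∑ j ∈ Finset.range N, (Real.exp b * ‖x‖) ^ j / (j.factorial : ℝ) := by
      positivity
    gcongr
    linarith

/-- The kernel at `a` of the space of all `q`-analytic functions, up to a constant factor, with
the exponential series truncated so as to obtain an element of `Pol n q`. -/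
noncomputable def truncatedKernel (m : ℝ) (n q : ℕ) (a w : ℂ) : ℂ :=
  (Real.exp (-(m * ‖a‖ ^ 2)) : ℂ) *
    (laguerre 1 (q - 1) (‖(Real.sqrt m : ℂ) * w + -((Real.sqrt m : ℂ) * a)‖ ^ 2) : ℂ) *
      ∑ j ∈ Finset.range (n - q), ((m : ℂ) * conj a * w) ^ j / j.factorial

theorem truncatedKernel_mem_Pol (m : ℝ) (n : ℕ) {q : ℕ} (hq : 1 ≤ q) (a : ℂ) :
    truncatedKernel m n q a ∈ Pol n q := by
  have h1 := mem_Pol_comp_affine (laguerre_mem_Pol hq) (Real.sqrt m : ℂ)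
    (-((Real.sqrt m : ℂ) * a))
  have h2 : truncatedKernel m n q a = ∑ j ∈ Finset.range (n - q),
      ((Real.exp (-(m * ‖a‖ ^ 2)) : ℂ) * ((m : ℂ) * conj a) ^ j / j.factorial) •
        fun w => w ^ j * (laguerre 1 (q - 1)
          (‖(Real.sqrt m : ℂ) * w + -((Real.sqrt m : ℂ) * a)‖ ^ 2) : ℂ) := by
    ext w
    simp only [truncatedKernel, Finset.mul_sum, Finset.sum_apply, Pi.smul_apply, smul_eq_mul]
    refine Finset.sum_congr rfl fun j _ => ?_
    ring
  rw [h2]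
  refine Submodule.sum_mem _ fun j hj => Submodule.smul_mem _ _
    (Pol_mono ?_ q (pow_mul_mem_Pol h1 j))
  have := Finset.mem_range.1 hj
  omega

theorem blowupTransform_truncatedKernel {m : ℝ} (hm : 0 < m) (n q : ℕ) (a ξ : ℂ) :
    blowupTransform m a (truncatedKernel m n q a) ξ =
      (laguerre 1 (q - 1) (‖ξ‖ ^ 2) : ℂ) *
        (Complex.exp (-((m : ℂ) * conj a * blowupPoint m a ξ)) *
          ∑ j ∈ Finset.range (n - q),
            ((m : ℂ) * conj a * blowupPoint m a ξ) ^ j / j.factorial) := by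
  have hs : (Real.sqrt m : ℂ) ≠ 0 := by exact_mod_cast (Real.sqrt_pos.2 hm).ne'
  have hm2 : (m : ℂ) = (Real.sqrt m : ℂ) ^ 2 := by
    rw [← Complex.ofReal_pow, Real.sq_sqrt hm.le]
  have h1 : (Real.sqrt m : ℂ) * blowupPoint m a ξ + -((Real.sqrt m : ℂ) * a) = ξ := by
    rw [blowupPoint]
    push_cast
    field_simp
    ring
  have h2 : Complex.exp (-((m : ℂ) * conj a * blowupPoint m a ξ)) =
      (Real.exp (-(m * ‖a‖ ^ 2)) : ℂ) * Complex.exp (-((Real.sqrt m : ℂ) * conj a) * ξ) := by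
    rw [Complex.ofReal_exp, ← Complex.exp_add]
    congr 1
    have h3 : ((‖a‖ : ℂ)) ^ 2 = a * conj a := by
      rw [Complex.mul_conj, Complex.normSq_eq_norm_sq]
      push_cast
      rfl
    push_cast
    rw [h3, blowupPoint, hm2]
    push_cast
    field_simp
    ring
  rw [blowupTransform, truncatedKernel, h1, h2]
  ring

/-- The exponents behind the estimate of the truncation error: Young's inequality absorbs the
mixed term, and a part of the Gaussian weight is kept for the sake of integrability. -/
theorem exponent_le {m : ℝ} (hm : 0 < m) (a ξ : ℂ) {b θ : ℝ} (hθ : 0 < θ) (hθ1 : θ < 1) :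
    2 * (Real.exp (b / 2) * (m * ‖a‖ * ‖blowupPoint m a ξ‖)) -
        m * ‖blowupPoint m a ξ‖ ^ 2 - m * ‖a‖ ^ 2 ≤
      m * (‖a‖ ^ 2 * (Real.exp b / θ - θ)) - (1 - θ) / 2 * ‖ξ‖ ^ 2 := by
  have h1 : ‖ξ‖ ^ 2 = m * ‖blowupPoint m a ξ - a‖ ^ 2 := by
    rw [blowupPoint, add_sub_cancel_left, norm_mul, Complex.norm_real, Real.norm_eq_abs, mul_pow,
      sq_abs, inv_pow, Real.sq_sqrt hm.le, mul_inv_cancel_left₀ hm.ne']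
  have h2 : ‖blowupPoint m a ξ - a‖ ≤ ‖blowupPoint m a ξ‖ + ‖a‖ := norm_sub_le _ _
  have h3 : ‖blowupPoint m a ξ - a‖ ^ 2 ≤ 2 * ‖blowupPoint m a ξ‖ ^ 2 + 2 * ‖a‖ ^ 2 := by
    nlinarith [norm_nonneg (blowupPoint m a ξ - a), sq_nonneg (‖blowupPoint m a ξ‖ - ‖a‖)]
  have h4 : Real.exp b = Real.exp (b / 2) ^ 2 := by
    rw [← Real.exp_nat_mul]
    push_cast
    ring_nf
  rw [h1, h4]
  generalize ‖blowupPoint m a ξ - a‖ = d at *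
  generalize ‖blowupPoint m a ξ‖ = w at *
  generalize ‖a‖ = r at *
  generalize Real.exp (b / 2) = s at *
  have h5 : 2 * s * r * w ≤ θ * w ^ 2 + s ^ 2 * r ^ 2 / θ := by
    have h6 : θ * w ^ 2 + s ^ 2 * r ^ 2 / θ - 2 * s * r * w = (θ * w - s * r) ^ 2 / θ := by
      field_simp
      ring
    have h7 : 0 ≤ (θ * w - s * r) ^ 2 / θ := by positivity
    linarith
  have h8 : (1 - θ) / 2 * d ^ 2 ≤ (1 - θ) / 2 * (2 * w ^ 2 + 2 * r ^ 2) :=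
    mul_le_mul_of_nonneg_left h3 (by linarith)
  have h9 : 2 * s * r * w - w ^ 2 - r ^ 2 ≤
      r ^ 2 * (s ^ 2 / θ - θ) - (1 - θ) / 2 * d ^ 2 := by
    have : r ^ 2 * (s ^ 2 / θ - θ) = s ^ 2 * r ^ 2 / θ - θ * r ^ 2 := by ring
    linarith
  have h10 := mul_le_mul_of_nonneg_left h9 hm.le
  linarith

theorem norm_blowupTransform_truncatedKernel_sub_sq_le {m : ℝ} (hm : 0 < m) (n q : ℕ) (a ξ : ℂ)
    {b θ : ℝ} (hb : 0 ≤ b) (hθ : 0 < θ) (hθ1 : θ < 1) :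
    ‖blowupTransform m a (truncatedKernel m n q a) ξ - (laguerre 1 (q - 1) (‖ξ‖ ^ 2) : ℂ)‖ ^ 2 *
        Real.exp (-1 * ‖ξ‖ ^ 2) ≤
      Real.exp (m * (‖a‖ ^ 2 * (Real.exp b / θ - θ)) - b * (n - q : ℕ)) *
        (laguerre 1 (q - 1) (‖ξ‖ ^ 2) ^ 2 * Real.exp (-((1 - θ) / 2) * ‖ξ‖ ^ 2)) := by
  have hexp := exponent_le hm a ξ (b := b) hθ hθ1
  have hw := mul_norm_blowupPoint_sq hm a ξ
  have hs : (Real.sqrt m : ℂ) ≠ 0 := by exact_mod_cast (Real.sqrt_pos.2 hm).ne'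
  have hm2 : (m : ℂ) = (Real.sqrt m : ℂ) ^ 2 := by
    rw [← Complex.ofReal_pow, Real.sq_sqrt hm.le]
  have hx : (m : ℂ) * conj a * blowupPoint m a ξ =
      ((m * ‖a‖ ^ 2 : ℝ) : ℂ) + (Real.sqrt m : ℂ) * conj a * ξ := by
    have h3 : ((‖a‖ : ℂ)) ^ 2 = a * conj a := by
      rw [Complex.mul_conj, Complex.normSq_eq_norm_sq]
      push_cast
      rfl
    push_cast
    rw [h3, blowupPoint, hm2]
    push_cast
    field_simp
  have hre : ((m : ℂ) * conj a * blowupPoint m a ξ).re =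
      m * ‖a‖ ^ 2 + ((Real.sqrt m : ℂ) * conj a * ξ).re := by
    rw [hx, Complex.add_re, Complex.ofReal_re]
  have hnorm : ‖(m : ℂ) * conj a * blowupPoint m a ξ‖ = m * ‖a‖ * ‖blowupPoint m a ξ‖ := by
    rw [norm_mul, norm_mul, RCLike.norm_conj, Complex.norm_real, Real.norm_of_nonneg hm.le]
  rw [blowupTransform_truncatedKernel hm]
  set x := (m : ℂ) * conj a * blowupPoint m a ξ with hxdef
  have htail := norm_exp_sub_sum_le_exp x (n - q) (b := b / 2) (by positivity)
  set E := ∑ j ∈ Finset.range (n - q), x ^ j / (j.factorial : ℂ)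
  set L := laguerre 1 (q - 1) (‖ξ‖ ^ 2)
  have h1 : (L : ℂ) * (Complex.exp (-x) * E) - L =
      -(L * (Complex.exp (-x) * (Complex.exp x - E))) := by
    have h2 : Complex.exp (-x) * Complex.exp x = 1 := by
      rw [← Complex.exp_add, neg_add_cancel, Complex.exp_zero]
    linear_combination (L : ℂ) * h2
  rw [h1, norm_neg, norm_mul, norm_mul, Complex.norm_real, Real.norm_eq_abs, mul_pow, sq_abs,
    Complex.norm_exp, Complex.neg_re]
  calc L ^ 2 * (Real.exp (-x.re) * ‖Complex.exp x - E‖) ^ 2 * Real.exp (-1 * ‖ξ‖ ^ 2)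
      ≤ L ^ 2 * (Real.exp (-x.re) * (Real.exp (-(b / 2 * (n - q : ℕ))) *
          Real.exp (Real.exp (b / 2) * ‖x‖))) ^ 2 * Real.exp (-1 * ‖ξ‖ ^ 2) := by gcongr
    _ = L ^ 2 * Real.exp (2 * (Real.exp (b / 2) * (m * ‖a‖ * ‖blowupPoint m a ξ‖)) -
          m * ‖blowupPoint m a ξ‖ ^ 2 - m * ‖a‖ ^ 2 - b * (n - q : ℕ)) := by
        rw [← Real.exp_add, ← Real.exp_add, ← Real.exp_nat_mul, mul_assoc, ← Real.exp_add, hnorm,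
          hw, hre]
        push_cast
        ring_nf
    _ ≤ L ^ 2 * Real.exp ((m * (‖a‖ ^ 2 * (Real.exp b / θ - θ)) - b * (n - q : ℕ)) +
          -((1 - θ) / 2) * ‖ξ‖ ^ 2) := by
        gcongr
        linarith
    _ = _ := by
        rw [Real.exp_add]
        ring

/-- The rate of growth left by `exponent_le` is beaten by the factor `exp (-b n)` coming from the
tail of the exponential series. -/
theorem exists_exponent {ρ : ℝ} (hρ0 : 0 ≤ ρ) (hρ : ρ < 1) :
    ∃ b θ : ℝ, 0 ≤ b ∧ 0 < θ ∧ θ < 1 ∧ ρ * (Real.exp b / θ - θ) < b := by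
  -- for `θ = 1` and `exp b = 2 / (1 + ρ)` the claim follows from `log x ≥ 1 - 1 / x`
  have hS : 0 < 2 / (1 + ρ) := by positivity
  have hlog := Real.one_sub_inv_le_log_of_pos hS
  rw [inv_div] at hlog
  have h1 : ρ * (2 / (1 + ρ) / 1 - 1) < Real.log (2 / (1 + ρ)) := by
    refine lt_of_lt_of_le ?_ hlog
    have h2 : 1 - (1 + ρ) / 2 - ρ * (2 / (1 + ρ) / 1 - 1) = (1 - ρ) ^ 2 / (2 * (1 + ρ)) := by
      field_simp
      ring
    have h3 : 0 < (1 - ρ) ^ 2 / (2 * (1 + ρ)) := by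
      have : 0 < 1 - ρ := by linarith
      positivity
    linarith
  have hcont : ContinuousAt (fun θ : ℝ => ρ * (2 / (1 + ρ) / θ - θ)) 1 :=
    continuousAt_const.mul ((continuousAt_const.div continuousAt_id one_ne_zero).sub
      continuousAt_id)
  have hev : ∀ᶠ θ in 𝓝[<] (1 : ℝ), ρ * (2 / (1 + ρ) / θ - θ) < Real.log (2 / (1 + ρ)) :=
    nhdsWithin_le_nhds (hcont.eventually_lt_const h1)
  have hev0 : ∀ᶠ θ in 𝓝[<] (1 : ℝ), 0 < θ := nhdsWithin_le_nhds (lt_mem_nhds one_pos)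
  obtain ⟨θ, h4, h5, h6⟩ := (hev.and (hev0.and self_mem_nhdsWithin)).exists
  refine ⟨Real.log (2 / (1 + ρ)), θ, by linarith, h5, h6, ?_⟩
  rwa [Real.exp_log hS]

/-- At points of the open unit disc the limit kernel is approximated by elements of the space
with an error that decays exponentially in `m`. -/
theorem exists_mem_Pol_integral_le {q : ℕ} (hq : 1 ≤ q) {a : ℂ} (ha : ‖a‖ < 1) (M : ℝ) :
    ∃ C κ : ℝ, 0 < κ ∧ ∀ (m : ℝ) (n : ℕ), 0 < m → |(n : ℝ) - m| ≤ M → ∃ T ∈ Pol n q,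
      ∫ ξ, ‖blowupTransform m a T ξ - (laguerre 1 (q - 1) (‖ξ‖ ^ 2) : ℂ)‖ ^ 2 *
        Real.exp (-1 * ‖ξ‖ ^ 2) ∂dA ≤ C * Real.exp (-(κ * m)) := by
  obtain ⟨b, θ, hb, hθ, hθ1, hκ⟩ := exists_exponent (ρ := ‖a‖ ^ 2) (by positivity)
    (by nlinarith [norm_nonneg a])
  set B := ∫ ξ : ℂ, laguerre 1 (q - 1) (‖ξ‖ ^ 2) ^ 2 *
    Real.exp (-((1 - θ) / 2) * ‖ξ‖ ^ 2) ∂dA with hB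
  have hB0 : 0 ≤ B := integral_nonneg fun ξ => by positivity
  have hL := IsSubgaussian.of_mem_Pol (laguerre_mem_Pol hq)
  have hint : Integrable (fun ξ : ℂ => laguerre 1 (q - 1) (‖ξ‖ ^ 2) ^ 2 *
      Real.exp (-((1 - θ) / 2) * ‖ξ‖ ^ 2)) dA := by
    refine (hL.integrable_norm_sq (b := (1 - θ) / 2) (by linarith)).congr
      (ae_of_all _ fun ξ => ?_)
    simp only [Complex.norm_real, Real.norm_eq_abs, sq_abs]
  refine ⟨B * Real.exp (b * (M + q)), b - ‖a‖ ^ 2 * (Real.exp b / θ - θ), by linarith,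
    fun m n hm hmn => ⟨truncatedKernel m n q a, truncatedKernel_mem_Pol m n hq a, ?_⟩⟩
  have hle := integral_mono_of_nonneg (μ := dA) (ae_of_all _ fun ξ => by positivity)
    (hint.const_mul (Real.exp (m * (‖a‖ ^ 2 * (Real.exp b / θ - θ)) - b * (n - q : ℕ))))
    (ae_of_all _ fun ξ =>
      norm_blowupTransform_truncatedKernel_sub_sq_le hm n q a ξ hb hθ hθ1)
  refine hle.trans ?_
  rw [integral_const_mul, ← hB, mul_comm, mul_assoc, ← Real.exp_add]
  gcongr
  have h1 : (n : ℝ) - q ≤ (n - q : ℕ) := by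
    rw [sub_le_iff_le_add]
    exact_mod_cast (by omega : n ≤ n - q + q)
  have h2 : m - M - q ≤ (n - q : ℕ) := by linarith [(abs_le.1 hmn).1]
  have h3 := mul_le_mul_of_nonneg_left h2 hb
  linarith

/-! ### Convergence of the Berezin densities and measures -/

theorem tendsto_fst_jointLimit (M : ℝ) : Tendsto Prod.fst (jointLimit M) atTop :=
  tendsto_fst.mono_left inf_le_left

theorem eventually_jointLimit (M : ℝ) :
    ∀ᶠ p : ℝ × ℕ in jointLimit M, 0 < p.1 ∧ |(p.2 : ℝ) - p.1| ≤ M :=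
  ((tendsto_fst_jointLimit M).eventually (eventually_gt_atTop 0)).and
    (mem_inf_of_right (mem_principal_self _))

theorem eventually_polyKernel_diag_pos_and_integral_lt {q : ℕ} (hq : 1 ≤ q) {a : ℂ}
    (ha : ‖a‖ < 1) (M : ℝ) {ε : ℝ} (hε : 0 < ε) :
    ∀ᶠ p : ℝ × ℕ in jointLimit M, 0 < (polyKernel p.1 p.2 q a a).re ∧
      ∫ ξ, |blowupBerezinDensity p.1 p.2 q a ξ - limitDensity q ξ| ∂dA < ε := by
  obtain ⟨C, κ, hκ, h⟩ := exists_mem_Pol_integral_le hq ha M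
  have hq0 : (0 : ℝ) < q := by exact_mod_cast hq
  have h0 : Tendsto (fun m : ℝ => C * Real.exp (-(κ * m))) atTop (𝓝 0) := by
    simpa using (Real.tendsto_exp_neg_atTop_nhds_zero.comp
      (tendsto_id.const_mul_atTop hκ)).const_mul C
  have h1 : Tendsto (fun m : ℝ => (2 + (ε / 2)⁻¹) * (C * Real.exp (-(κ * m)) / q)) atTop
      (𝓝 0) := by
    simpa using (h0.div_const (q : ℝ)).const_mul (2 + (ε / 2)⁻¹)
  filter_upwards [eventually_jointLimit M,
    (tendsto_fst_jointLimit M).eventually (h0.eventually_lt_const hq0),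
    (tendsto_fst_jointLimit M).eventually (h1.eventually_lt_const (half_pos hε))]
    with p hp hp0 hp1
  obtain ⟨T, hT, hTle⟩ := h p.1 p.2 hp.1 hp.2
  obtain ⟨h2, h3⟩ :=
    integral_abs_blowupBerezinDensity_sub_le hp.1 hq a hT (half_pos hε) hp0 hTle
  exact ⟨h2, by linarith⟩

theorem integrable_blowupBerezinDensity {m : ℝ} (hm : 0 < m) (n q : ℕ) (a : ℂ) :
    Integrable (blowupBerezinDensity m n q a) dA := by
  refine (((isSubgaussian_blowupKernel (n := n) (q := q) hm a).integrable_norm_sq one_pos).div_const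
    (blowupDiag m n q a)).congr (ae_of_all _ fun ξ => ?_)
  exact (blowupBerezinDensity_eq hm a ξ).symm

theorem tendsto_integral_abs_blowupBerezinDensity_sub {q : ℕ} (hq : 1 ≤ q) {a : ℂ}
    (ha : ‖a‖ < 1) (M : ℝ) :
    Tendsto (fun p : ℝ × ℕ =>
      ∫ ξ, |blowupBerezinDensity p.1 p.2 q a ξ - limitDensity q ξ| ∂dA) (jointLimit M) (𝓝 0) := by
  rw [Metric.tendsto_nhds]
  intro ε hε
  filter_upwards [eventually_polyKernel_diag_pos_and_integral_lt hq ha M hε] with p hp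
  rw [Real.dist_0_eq_abs, abs_of_nonneg (integral_nonneg fun ξ => abs_nonneg _)]
  exact hp.2

theorem tendsto_blowupPoint (a ξ : ℂ) :
    Tendsto (fun m => blowupPoint m a ξ) atTop (𝓝 a) := by
  have h1 : Tendsto (fun m : ℝ => (Real.sqrt m)⁻¹) atTop (𝓝 0) :=
    tendsto_inv_atTop_zero.comp Real.tendsto_sqrt_atTop
  have h2 := (((Complex.continuous_ofReal.tendsto 0).comp h1).mul_const ξ).const_add a
  simpa [blowupPoint, Function.comp_def] using h2

theorem continuous_blowupPoint (m : ℝ) (a : ℂ) : Continuous (blowupPoint m a) := by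
  unfold blowupPoint
  fun_prop

theorem tendsto_integral_mul_limitDensity {q : ℕ} (hq : 1 ≤ q) (a : ℂ) (f : ℂ →ᵇ ℝ) :
    Tendsto (fun m : ℝ => ∫ ξ, f (blowupPoint m a ξ) * limitDensity q ξ ∂dA) atTop
      (𝓝 (f a)) := by
  have hl := integrable_limitDensity hq
  have h : Tendsto (fun m : ℝ => ∫ ξ, f (blowupPoint m a ξ) * limitDensity q ξ ∂dA) atTop
      (𝓝 (∫ ξ, f a * limitDensity q ξ ∂dA)) := by
    refine tendsto_integral_filter_of_dominated_convergence
      (fun ξ => ‖f‖ * ‖limitDensity q ξ‖) (Eventually.of_forall fun m => ?_)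
      (Eventually.of_forall fun m => ae_of_all _ fun ξ => ?_) (hl.norm.const_mul _)
      (ae_of_all _ fun ξ => ?_)
    · exact (f.continuous.comp (continuous_blowupPoint m a)).aestronglyMeasurable.mul hl.1
    · rw [norm_mul]
      gcongr
      exact f.norm_coe_le_norm _
    · exact ((f.continuous.tendsto a).comp (tendsto_blowupPoint a ξ)).mul_const _
  rwa [integral_const_mul, integral_limitDensity hq, mul_one] at h

theorem tendsto_integral_berezinMeasure {q : ℕ} (hq : 1 ≤ q) {a : ℂ} (ha : ‖a‖ < 1) (M : ℝ)
    (f : ℂ →ᵇ ℝ) :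
    Tendsto (fun p : ℝ × ℕ => ∫ w, f w ∂(berezinMeasure p.1 p.2 q a)) (jointLimit M)
      (𝓝 (f a)) := by
  have h1 := (tendsto_integral_mul_limitDensity hq a f).comp (tendsto_fst_jointLimit M)
  refine h1.congr_dist (squeeze_zero' (Eventually.of_forall fun p => dist_nonneg) ?_
    (by simpa using (tendsto_integral_abs_blowupBerezinDensity_sub hq ha M).const_mul ‖f‖))
  filter_upwards [eventually_jointLimit M,
    eventually_polyKernel_diag_pos_and_integral_lt hq ha M one_pos] with p hp hpos
  have hb := integrable_blowupBerezinDensity hp.1 p.2 q a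
  have hl := integrable_limitDensity hq
  have hf : AEStronglyMeasurable (fun ξ => f (blowupPoint p.1 a ξ)) dA :=
    (f.continuous.comp (continuous_blowupPoint p.1 a)).aestronglyMeasurable
  have hfb : ∀ ξ, ‖f (blowupPoint p.1 a ξ)‖ ≤ ‖f‖ := fun ξ => f.norm_coe_le_norm _
  rw [integral_berezinMeasure hp.1 hpos.1, dist_comm, Function.comp_apply, dist_eq_norm,
    ← integral_sub (hb.bdd_mul hf (ae_of_all _ hfb)) (hl.bdd_mul hf (ae_of_all _ hfb)),
    ← integral_const_mul]
  refine norm_integral_le_of_norm_le ((hb.sub hl).abs.const_mul _) (ae_of_all _ fun ξ => ?_)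
  rw [← mul_sub, norm_mul]
  exact mul_le_mul_of_nonneg_right (hfb ξ) (abs_nonneg _)

end PolyGinibre

theorem mainTheorem3 (q : ℕ) (hq : 1 ≤ q) (z : ℂ) (hz : ‖z‖ < 1) (M : ℝ) :
    Tendsto
        (fun p : ℝ × ℕ =>
          ∫⁻ ξ, ENNReal.ofReal |blowupBerezinDensity p.1 p.2 q z ξ - limitDensity q ξ| ∂dA)
        (jointLimit M) (𝓝 0) ∧
      (∀ᶠ p : ℝ × ℕ in jointLimit M, IsProbabilityMeasure (berezinMeasure p.1 p.2 q z)) ∧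
      ∀ f : ℂ →ᵇ ℝ,
        Tendsto (fun p : ℝ × ℕ => ∫ w, f w ∂(berezinMeasure p.1 p.2 q z))
          (jointLimit M) (𝓝 (∫ w, f w ∂(Measure.dirac z))) := by
  refine ⟨?_, ?_, fun f => ?_⟩
  · have h := ENNReal.tendsto_ofReal (tendsto_integral_abs_blowupBerezinDensity_sub hq hz M)
    rw [ENNReal.ofReal_zero] at h
    refine h.congr' ?_
    filter_upwards [eventually_jointLimit M] with p hp
    exact ofReal_integral_eq_lintegral_ofReal
      ((integrable_blowupBerezinDensity hp.1 p.2 q z).sub (integrable_limitDensity hq)).abs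
      (ae_of_all _ fun ξ => abs_nonneg _)
  · filter_upwards [eventually_jointLimit M,
      eventually_polyKernel_diag_pos_and_integral_lt hq hz M one_pos] with p hp hpos
    exact isProbabilityMeasure_berezinMeasure hp.1 hpos.1
  · rw [integral_dirac]
    exact tendsto_integral_berezinMeasure hq hz M f
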